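/- Let $K$ be a field (for instance $\mathbb C$) and let $q\in K$ be non-zero and not a root of unity. Write $[n]=q^{-n}-q^{n}$, $[n]!=[1][2]\cdots[n]$ and $(q^2;q^2)_n=\prod_{k=1}^n(1-q^{2k})$. Let $F$ be the vector space with basis $|n_1,\dots,n_6\rangle$, $n_j\in\mathbb Z_{\ge0}$ (the sixth tensor power of the Fock space), and write $\langle m|X|n\rangle$ for the coefficient of $|m\rangle$ in $X|n\rangle$. Let $\mathtt r$ be the operator on the threefold tensor power of the Fock space with matrix elements $$\langle m_1,m_2,m_3|\mathtt r|n_1,n_2,n_3\rangle=\mathtt r_{m_1,m_2,m_3}^{n_1,n_2,n_3}=\delta_{m_1+m_2,n_1+n_2}\,\delta_{m_2+m_3,n_2+n_3}\,\frac{q^{(m_1-n_2)(m_3-n_2)}}{(q^2;q^2)_{m_2}}\,P_{m_2}(q^{2n_1},q^{2n_2},q^{2n_3}),$$ where $P_0=1$ and $$P_{m+1}(x,y,z)=(1-x)(1-z)P_m(x/q^2,y,z/q^2)-\frac{xz}{q^{2m}}(1-y)P_m(x,y/q^2,z).$$ Let $\mathtt r_{ijk}$ be the operator on $F$ acting as $\mathtt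 r$ in the tensor components $i,j,k$ and as the identity in the others. For $\lambda_1,\dots,\lambda_6,\mu_1,\dots,\mu_6\in K\setminus\{0\}$ put $$R_{ijk}=\Big(-\frac{\lambda_i\mu_k}{q}\Big)^{N_j}\,\mathtt r_{ijk}\,\Big(\frac{\lambda_k}{\lambda_j}\Big)^{N_i}\Big(\frac{\mu_i}{\mu_j}\Big)^{N_k},\qquad x^{N_i}|n\rangle=x^{n_i}|n\rangle .$$ Let $\mathscr B_3=\mathscr U_q(\mathfrak n_+)\subset\mathscr U_q(sl_4)$, that is, the unital associative $K$-algebra generated by $e_1,e_2,e_3$ with relations $e_i^2e_j+e_je_i^2=(q^{-1}+q)\,e_ie_je_i$ for $|i-j|=1$ and $e_1e_3=e_3e_1$. Put $$e_{12}=\frac{e_1e_2-qe_2e_1}{[1]},\quad e_{23}=\frac{e_2e_3-qe_3e_2}{[1]},\quad e_{123}=\frac{e_1e_{23}-qe_{23}e_1}{[1]},$$ $$\tilde e_{12}=\frac{e_2e_1-qe_1e_2}{[1]},\quad \tilde e_{23}=\frac{e_3e_2-qe_2e_3}{[1]},\quad \tilde e_{123}=\frac{\tilde e_{23}e_1-qe_1\tilde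 e_{23}}{[1]},$$ and, for $n,m\in\mathbb Z_{\ge0}^6$, $$E_n=\frac{e_3^{n_6}e_{23}^{n_5}e_{123}^{n_4}e_2^{n_3}e_{12}^{n_2}e_1^{n_1}}{[n_6]!\cdots[n_1]!},\qquad \tilde E_m=\frac{e_1^{m_1}\tilde e_{12}^{m_2}\tilde e_{123}^{m_4}e_2^{m_3}\tilde e_{23}^{m_5}e_3^{m_6}}{[m_1]!\cdots[m_6]!}.$$ Then: 1. $\{E_n\}$ and $\{\tilde E_m\}$ are bases of $\mathscr B_3$, and the coefficients $T_m^n$ of the decomposition $\tilde E_m=\sum_nT_m^nE_n$ are given both by $T_m^n=\langle m|T^{(1)}|n\rangle$ and by $T_m^n=\langle m|T^{(2)}|n\rangle$, where $$T^{(1)}=\mathtt r_{123}\mathtt r_{145}\mathtt r_{246}\mathtt r_{356},\qquad T^{(2)}=\mathtt r_{356}\mathtt r_{246}\mathtt r_{145}\mathtt r_{123}.$$ 2. $T^{(1)}=T^{(2)}$, i.e. the constant tetrahedron equation $\mathtt r_{123}\mathtt r_{145}\mathtt r_{246}\mathtt r_{356}=\mathtt r_{356}\mathtt r_{246}\mathtt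 r_{145}\mathtt r_{123}$ holds on $F$. 3. For all non-zero $\lambda_j,\mu_j$, also $R_{123}R_{145}R_{246}R_{356}=R_{356}R_{246}R_{145}R_{123}$ on $F$. -/

import Mathlib

namespace QTetra

/-! ### The algebra `B_n`, the positive part of quantum `sl_{n+1}` -/

section Algebra

variable {K : Type*} [Field K]

/-- The `q`-Serre relations between the generators `e_0, …, e_{n-1}`. -/
inductive SerreRel (q : K) (n : ℕ) : FreeAlgebra K (Fin n) → FreeAlgebra K (Fin n) → Prop
  | adjacent (i j : Fin n) (h : (i : ℕ) + 1 = j ∨ (j : ℕ) + 1 = i) :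
      SerreRel q n
        (FreeAlgebra.ι K i ^ 2 * FreeAlgebra.ι K j + FreeAlgebra.ι K j * FreeAlgebra.ι K i ^ 2)
        ((q⁻¹ + q) • (FreeAlgebra.ι K i * FreeAlgebra.ι K j * FreeAlgebra.ι K i))
  | distant (i j : Fin n) (h : (i : ℕ) + 1 < j ∨ (j : ℕ) + 1 < i) :
      SerreRel q n
        (FreeAlgebra.ι K i * FreeAlgebra.ι K j) (FreeAlgebra.ι K j * FreeAlgebra.ι K i)

/-- `B_n`: the unital associative `K`-algebra generated by `e_0, …, e_{n-1}` subject to the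
`q`-Serre relations. -/
abbrev Nilp (q : K) (n : ℕ) : Type _ := RingQuot (SerreRel q n)

/-- The generators of `B_n`. -/
def gen (q : K) (n : ℕ) (i : Fin n) : Nilp q n :=
  RingQuot.mkAlgHom K (SerreRel q n) (FreeAlgebra.ι K i)

/-- `[n] = q^{-n} - q^n`. -/
def qNum (q : K) (n : ℕ) : K := q⁻¹ ^ n - q ^ n

/-- `[n]! = [1][2]⋯[n]`. -/
def qFact (q : K) (n : ℕ) : K := ∏ k ∈ Finset.range n, qNum q (k + 1)

/-- `(x y - q y x) / [1]`. -/
def qBracket {A : Type*} [Ring A] [Algebra K A] (q : K) (x y : A) : A :=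
  (qNum q 1)⁻¹ • (x * y - q • (y * x))

/-- The generator `e_1` of `B_3`. -/
def e1 (q : K) : Nilp q 3 := gen q 3 0

/-- The generator `e_2` of `B_3`. -/
def e2 (q : K) : Nilp q 3 := gen q 3 1

/-- The generator `e_3` of `B_3`. -/
def e3 (q : K) : Nilp q 3 := gen q 3 2

/-- `e_{12} = (e_1 e_2 - q e_2 e_1) / [1]`. -/
def e12 (q : K) : Nilp q 3 := qBracket q (e1 q) (e2 q)

/-- `e_{23} = (e_2 e_3 - q e_3 e_2) / [1]`. -/
def e23 (q : K) : Nilp q 3 := qBracket q (e2 q) (e3 q)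

/-- `e_{123} = (e_1 e_{23} - q e_{23} e_1) / [1]`. -/
def e123 (q : K) : Nilp q 3 := qBracket q (e1 q) (e23 q)

/-- `ẽ_{12} = (e_2 e_1 - q e_1 e_2) / [1]`. -/
def e12t (q : K) : Nilp q 3 := qBracket q (e2 q) (e1 q)

/-- `ẽ_{23} = (e_3 e_2 - q e_2 e_3) / [1]`. -/
def e23t (q : K) : Nilp q 3 := qBracket q (e3 q) (e2 q)

/-- `ẽ_{123} = (ẽ_{23} e_1 - q e_1 ẽ_{23}) / [1]`. -/
def e123t (q : K) : Nilp q 3 := qBracket q (e23t q) (e1 q)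

/-- The normalisation `[n_1]! [n_2]! ⋯ [n_6]!`; the exponent `n_s` is `n (s-1)`. -/
def normFactor (q : K) (n : Fin 6 → ℕ) : K := ∏ s, qFact q (n s)

/-- `e_3^{n_6} e_{23}^{n_5} e_{123}^{n_4} e_2^{n_3} e_{12}^{n_2} e_1^{n_1} / ([n_6]! ⋯ [n_1]!)`. -/
def pbw (q : K) (n : Fin 6 → ℕ) : Nilp q 3 :=
  (normFactor q n)⁻¹ •
    (e3 q ^ n 5 * e23 q ^ n 4 * e123 q ^ n 3 * e2 q ^ n 2 * e12 q ^ n 1 * e1 q ^ n 0)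

/-- `e_1^{m_1} ẽ_{12}^{m_2} ẽ_{123}^{m_4} e_2^{m_3} ẽ_{23}^{m_5} e_3^{m_6} / ([m_1]! ⋯ [m_6]!)`
(note the position of `m_4` before `m_3`). -/
def pbwTilde (q : K) (m : Fin 6 → ℕ) : Nilp q 3 :=
  (normFactor q m)⁻¹ •
    (e1 q ^ m 0 * e12t q ^ m 1 * e123t q ^ m 3 * e2 q ^ m 2 * e23t q ^ m 4 * e3 q ^ m 5)

end Algebra

/-! ### The matrix `r` and operators on the sixfold Fock space -/

section Fock

variable {K : Type*} [Field K]

/-- The polynomials `P_m(x,y,z)`:  `P_0 = 1` and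
`P_{m+1}(x,y,z) = (1-x)(1-z) P_m(x/q²,y,z/q²) - (xz/q^{2m}) (1-y) P_m(x,y/q²,z)`. -/
def polyP (q : K) : ℕ → K → K → K → K
  | 0, _, _, _ => 1
  | m + 1, x, y, z =>
      (1 - x) * (1 - z) * polyP q m (x / q ^ 2) y (z / q ^ 2)
        - x * z / q ^ (2 * m) * (1 - y) * polyP q m x (y / q ^ 2) z

/-- `(q²;q²)_n = (1-q²)(1-q⁴)⋯(1-q^{2n})`. -/
def qPoch (q : K) (n : ℕ) : K := ∏ k ∈ Finset.range n, (1 - q ^ (2 * (k + 1)))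

/-- The matrix element `⟨m₁,m₂,m₃| r |n₁,n₂,n₃⟩`. -/
def rCoeff (q : K) (m₁ m₂ m₃ n₁ n₂ n₃ : ℕ) : K :=
  if m₁ + m₂ = n₁ + n₂ ∧ m₂ + m₃ = n₂ + n₃ then
    q ^ (((m₁ : ℤ) - n₂) * ((m₃ : ℤ) - n₂)) / qPoch q m₂
      * polyP q m₂ (q ^ (2 * n₁)) (q ^ (2 * n₂)) (q ^ (2 * n₃))
  else 0

/-- The sixfold tensor power of the Fock space: its basis vectors `|n₁,…,n₆⟩` are
`Finsupp.single n 1`. -/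
abbrev Fock6 (K : Type*) [Field K] : Type _ := (Fin 6 → ℕ) →₀ K

/-- The matrix element `⟨m| r_{ijk} |n⟩` on the sixfold Fock space: `r` acts in the components
`i, j, k` and the identity acts in all others. -/
def rEntry (q : K) (i j k : Fin 6) (m n : Fin 6 → ℕ) : K :=
  if ∀ s, s ≠ i → s ≠ j → s ≠ k → m s = n s then
    rCoeff q (m i) (m j) (m k) (n i) (n j) (n k)
  else 0

/-- Every column of `r_{ijk}` has finitely many non-zero entries. -/
theorem rEntry_finite (q : K) (i j k : Fin 6) (n : Fin 6 → ℕ) :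
    (Function.support fun m => rEntry q i j k m n).Finite := by
  refine (Set.finite_Iic (fun s : Fin 6 => n s + n i + n j + n k)).subset ?_
  intro m hm s
  have hm' : rEntry q i j k m n ≠ 0 := hm
  unfold rEntry rCoeff at hm'
  split_ifs at hm' with h1 h2
  · show m s ≤ n s + n i + n j + n k
    by_cases hi : s = i
    · subst hi; omega
    by_cases hj : s = j
    · subst hj; omega
    by_cases hk : s = k
    · subst hk; omega
    have := h1 s hi hj hk
    omega
  · exact absurd rfl hm'
  · exact absurd rfl hm'

/-- The operator `r_{ijk}` on the sixfold Fock space: `r_{ijk} |n⟩ = ∑_m |m⟩ ⟨m| r_{ijk} |n⟩`. -/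
noncomputable def rOp (q : K) (i j k : Fin 6) : Module.End K (Fock6 K) :=
  Finsupp.linearCombination K fun n =>
    Finsupp.ofSupportFinite (fun m => rEntry q i j k m n) (rEntry_finite q i j k n)

/-- The operator `x^{N_i}`: `x^{N_i} |n⟩ = x^{n_i} |n⟩`. -/
noncomputable def powN (x : K) (i : Fin 6) : Module.End K (Fock6 K) :=
  Finsupp.linearCombination K fun n => Finsupp.single n (x ^ n i)

/-- The matrix element `⟨m| T |n⟩` of an operator on the sixfold Fock space. -/
noncomputable def matElem (T : Module.End K (Fock6 K)) (m n : Fin 6 → ℕ) : K :=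
  T (Finsupp.single n 1) m

/-- The operator with spectral parameters,
`R_{ijk} = (-λ_i μ_k / q)^{N_j} r_{ijk} (λ_k / λ_j)^{N_i} (μ_i / μ_j)^{N_k}`
(`l` and `u` stand for `λ` and `μ`). -/
noncomputable def ROp (q : K) (l u : Fin 6 → K) (i j k : Fin 6) : Module.End K (Fock6 K) :=
  powN (-(l i * u k) / q) j * rOp q i j k * powN (l k / l j) i * powN (u i / u j) k

/-- `T^{(1)} = r_{123} r_{145} r_{246} r_{356}`; the component `s` has index `s - 1`. -/
noncomputable def T₁ (q : K) : Module.End K (Fock6 K) :=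
  rOp q 0 1 2 * rOp q 0 3 4 * rOp q 1 3 5 * rOp q 2 4 5

/-- `T^{(2)} = r_{356} r_{246} r_{145} r_{123}`; the component `s` has index `s - 1`. -/
noncomputable def T₂ (q : K) : Module.End K (Fock6 K) :=
  rOp q 2 4 5 * rOp q 1 3 5 * rOp q 0 3 4 * rOp q 0 1 2

end Fock

end QTetra

/-!
Two elements `x, y` that satisfy the `q`-Serre relations are called a Serre pair. With
`w = [x, y]_q` and `w' = [y, x]_q`, the Serre relations say that `w` and `w'` commute with `x` and
`y` up to powers of `q`, and `w' = q (y x - w)`. Reordering `x^(a) w'^(b) y^(c)` (divided powers)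
into monomials `y^(n₃) w^(n₂) x^(n₁)` produces exactly the matrix `r` (`divPow_mul_swap`): for
`b = 0` this is a `q`-binomial expansion, and left multiplication by `w'` raises `b` by one and
reproduces the recursion that defines the polynomials `P_b` (`rRaw_succ`).

In `B_3` the monomials `Ẽ_m` are turned into the monomials `E_n` by four such reorderings, each in
a Serre pair formed by root vectors, together with exchanges of commuting root vectors. There are
two ways to do this, and they give the operators `T₁` and `T₂` (`linearCombination_monEt_T₁`,
`linearCombination_monEt_T₂`). A reordering expresses a monomial of index `m` by those of index `n`
with coefficients `⟨m| r |n⟩`, so it is the transpose of `r_{ijk}` that acts on indices.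

The `E_n` span `B_3`, because their span is stable under left multiplication by the generators
(`span_pbw`). The defining relations are invariant under reversal, so the transpose of this
action, extended to functions of six integers, is a representation of `B_3`. In it `Ẽ_m`, followed
by evaluation at the origin, is a non-zero multiple of evaluation at `m`; hence the `Ẽ_m` are
linearly independent (`linearIndependent_pbwTilde`).
The reversal of products maps `E_n` to `Ẽ_n`, so both families are bases, and `T₁ = T₂` because both
are the transition matrix. Finally, `r_{ijk}` commutes with the diagonal operators that respect its
conservation laws, and diagonal operators remove all spectral parameters from both sides of the
tetrahedron equation in the same way (`ROp_tetrahedron`).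
-/

namespace QTetra

variable {K : Type*} [Field K] {A : Type*} [Ring A] [Algebra K A]

/-! ### `q`-numbers and divided powers -/

/-- The `q`-number `[n] = q^{-n} - q^n` for an integer `n`. -/
def zNum (q : K) (n : ℤ) : K := q ^ (-n) - q ^ n

theorem qNum_eq_zNum (q : K) (n : ℕ) : qNum q n = zNum q n := by
  simp [qNum, zNum]

theorem zNum_zero (q : K) : zNum q 0 = 0 := by simp [zNum]

theorem qNum_ne_zero {q : K} (hq0 : q ≠ 0) (hq : ∀ n : ℕ, 0 < n → q ^ n ≠ 1) {n : ℕ}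
    (hn : 0 < n) : qNum q n ≠ 0 := by
  intro h
  refine hq (n + n) (by omega) ?_
  have h' : q⁻¹ ^ n = q ^ n := sub_eq_zero.mp h
  rw [pow_add]
  nth_rewrite 1 [← h']
  rw [← mul_pow, inv_mul_cancel₀ hq0, one_pow]

theorem qFact_ne_zero {q : K} (hq0 : q ≠ 0) (hq : ∀ n : ℕ, 0 < n → q ^ n ≠ 1) (n : ℕ) :
    qFact q n ≠ 0 :=
  Finset.prod_ne_zero_iff.mpr fun _ _ => qNum_ne_zero hq0 hq (Nat.succ_pos _)

theorem qFact_succ (q : K) (n : ℕ) : qFact q (n + 1) = qFact q n * qNum q (n + 1) :=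
  Finset.prod_range_succ _ _

/-- The divided power `x^n / [n]!`, extended by zero to negative exponents `n`. With this
convention the recursions below hold for all integers, without boundary cases. -/
def divPow (q : K) (x : A) : ℤ → A
  | Int.ofNat n => (qFact q n)⁻¹ • x ^ n
  | Int.negSucc _ => 0

theorem divPow_natCast (q : K) (x : A) (n : ℕ) :
    divPow q x (n : ℤ) = (qFact q n)⁻¹ • x ^ n := rfl

theorem divPow_zero (q : K) (x : A) : divPow q x 0 = 1 := by
  have := divPow_natCast q x 0
  simpa [qFact] using this

theorem divPow_of_neg (q : K) (x : A) {n : ℤ} (hn : n < 0) : divPow q x n = 0 := by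
  obtain ⟨m, rfl⟩ := Int.eq_negSucc_of_lt_zero hn
  rfl

theorem mul_divPow {q : K} (hq0 : q ≠ 0) (hq : ∀ n : ℕ, 0 < n → q ^ n ≠ 1) (x : A) (n : ℤ) :
    x * divPow q x n = zNum q (n + 1) • divPow q x (n + 1) := by
  rcases lt_trichotomy n (-1) with h | rfl | h
  · rw [divPow_of_neg q x (by omega), divPow_of_neg q x (by omega)]; simp
  · rw [divPow_of_neg q x (by omega)]; simp [zNum_zero]
  · obtain ⟨m, rfl⟩ := Int.eq_ofNat_of_zero_le (show 0 ≤ n by omega)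
    have h1 := qNum_ne_zero hq0 hq (Nat.succ_pos m)
    have h2 := qFact_ne_zero hq0 hq m
    rw [← Nat.cast_succ, ← qNum_eq_zNum, divPow_natCast, divPow_natCast, qFact_succ, mul_smul_comm,
      smul_smul, ← pow_succ']
    congr 1
    rw [Nat.succ_eq_add_one] at *
    field_simp

theorem commute_divPow_left (q : K) {x y : A} (h : Commute x y) (n : ℤ) :
    Commute (divPow q x n) y := by
  cases n with
  | ofNat n => exact (h.pow_left n).smul_left _
  | negSucc n => exact Commute.zero_left _

theorem commute_divPow (q : K) {x y : A} (h : Commute x y) (m n : ℤ) :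
    Commute (divPow q x m) (divPow q y n) :=
  commute_divPow_left q (commute_divPow_left q h.symm n).symm m

theorem divPow_mul {q : K} (hq0 : q ≠ 0) (hq : ∀ n : ℕ, 0 < n → q ^ n ≠ 1) (x : A) (n : ℤ) :
    divPow q x n * x = zNum q (n + 1) • divPow q x (n + 1) := by
  rw [← mul_divPow hq0 hq, (commute_divPow_left q (Commute.refl x) n).eq]

/-- An element that commutes with `v` up to the scalar `c` does so with divided powers of `v`. -/
theorem scalar_comm_divPow (q : K) {c : K} {u v : A} (h : u * v = c • (v * u)) (n : ℤ) :
    u * divPow q v n = c ^ n • (divPow q v n * u) := by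
  cases n with
  | negSucc n => rw [show divPow q v (Int.negSucc n) = 0 from rfl]; simp
  | ofNat n =>
    have key : u * v ^ n = c ^ n • (v ^ n * u) := by
      induction n with
      | zero => simp
      | succ n ih =>
        rw [pow_succ, ← mul_assoc, ih, smul_mul_assoc, mul_assoc, h, mul_smul_comm, smul_smul,
          ← mul_assoc, pow_succ c]
    rw [Int.ofNat_eq_natCast, divPow_natCast, mul_smul_comm, key, smul_mul_assoc, smul_comm,
      zpow_natCast]

/-! ### Serre pairs -/

/-- The pair `x, y` satisfies the two `q`-Serre relations. -/
structure IsSerrePair (q : K) (x y : A) : Prop where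
  left : x ^ 2 * y + y * x ^ 2 = (q⁻¹ + q) • (x * y * x)
  right : y ^ 2 * x + x * y ^ 2 = (q⁻¹ + q) • (y * x * y)

theorem IsSerrePair.symm {q : K} {x y : A} (h : IsSerrePair q x y) : IsSerrePair q y x :=
  ⟨h.right, h.left⟩

theorem qNum_one_smul_qBracket {q : K} (h1 : qNum q 1 ≠ 0) (x y : A) :
    qNum q 1 • qBracket q x y = x * y - q • (y * x) := by
  rw [qBracket, smul_smul, mul_inv_cancel₀ h1, one_smul]

/-- The first Serre relation is the `q`-commutation of `x` with `[x, y]_q`. -/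
theorem mul_qBracket_iff {q : K} (hq0 : q ≠ 0) (h1 : qNum q 1 ≠ 0) (x y : A) :
    x * qBracket q x y = q⁻¹ • (qBracket q x y * x) ↔
      x ^ 2 * y + y * x ^ 2 = (q⁻¹ + q) • (x * y * x) := by
  rw [qBracket, mul_smul_comm, smul_mul_assoc, smul_comm q⁻¹,
    (smul_right_injective A (inv_ne_zero h1)).eq_iff]
  have e : q⁻¹ • (q • (y * x * x)) = y * x * x := by rw [smul_smul, inv_mul_cancel₀ hq0, one_smul]
  rw [← sub_eq_zero, ← sub_eq_zero (b := (q⁻¹ + q) • _)]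
  have : x * (x * y - q • (y * x)) - q⁻¹ • ((x * y - q • (y * x)) * x) =
      x ^ 2 * y + y * x ^ 2 - (q⁻¹ + q) • (x * y * x) := by
    simp only [sub_mul, mul_sub, smul_sub, smul_mul_assoc, mul_smul_comm, pow_two, add_smul,
      mul_assoc] at e ⊢
    rw [e]; abel
  rw [this]

/-- The second Serre relation is the `q`-commutation of `[x, y]_q` with `y`. -/
theorem qBracket_mul_iff {q : K} (hq0 : q ≠ 0) (h1 : qNum q 1 ≠ 0) (x y : A) :
    qBracket q x y * y = q⁻¹ • (y * qBracket q x y) ↔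
      y ^ 2 * x + x * y ^ 2 = (q⁻¹ + q) • (y * x * y) := by
  rw [qBracket, mul_smul_comm, smul_mul_assoc, smul_comm q⁻¹,
    (smul_right_injective A (inv_ne_zero h1)).eq_iff]
  have e : q⁻¹ • (q • (y * y * x)) = y * y * x := by rw [smul_smul, inv_mul_cancel₀ hq0, one_smul]
  rw [← sub_eq_zero, ← sub_eq_zero (b := (q⁻¹ + q) • _)]
  have : (x * y - q • (y * x)) * y - q⁻¹ • (y * (x * y - q • (y * x))) =
      y ^ 2 * x + x * y ^ 2 - (q⁻¹ + q) • (y * x * y) := by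
    simp only [sub_mul, mul_sub, smul_sub, smul_mul_assoc, mul_smul_comm, pow_two, add_smul,
      mul_assoc] at e ⊢
    rw [e]; abel
  rw [this]

theorem mul_eq_qBracket {q : K} (h1 : qNum q 1 ≠ 0) (x y : A) :
    x * y = q • (y * x) + qNum q 1 • qBracket q x y := by
  rw [qNum_one_smul_qBracket h1]; abel

/-- Moving `x` through a divided power of `y`. -/
theorem mul_divPow_qBracket {q : K} (hq0 : q ≠ 0) (hq : ∀ n : ℕ, 0 < n → q ^ n ≠ 1) {x y : A}
    (h : qBracket q x y * y = q⁻¹ • (y * qBracket q x y)) (n : ℤ) :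
    x * divPow q y n = q ^ n • (divPow q y n * x) + divPow q y (n - 1) * qBracket q x y := by
  rcases lt_or_ge n 0 with hn | hn
  · rw [divPow_of_neg q y hn, divPow_of_neg q y (by omega)]; simp
  · induction n, hn using Int.leInduction with
    | base => rw [divPow_zero, divPow_of_neg q y (by omega)]; simp
    | succ n hn ih =>
      have h1 := qNum_ne_zero hq0 hq one_pos
      have hz : zNum q (n + 1) ≠ 0 := by
        obtain ⟨m, rfl⟩ := Int.eq_ofNat_of_zero_le hn
        rw [← Nat.cast_succ, ← qNum_eq_zNum]; exact qNum_ne_zero hq0 hq (Nat.succ_pos m)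
      apply smul_right_injective A hz
      have hw : divPow q y n * y = zNum q (n + 1) • divPow q y (n + 1) := divPow_mul hq0 hq y n
      have hw' : divPow q y (n - 1) * y = zNum q n • divPow q y n := by
        simpa using divPow_mul hq0 hq y (n - 1)
      show zNum q (n + 1) • (x * divPow q y (n + 1)) = zNum q (n + 1) • (_ + _)
      rw [← mul_smul_comm, ← hw, ← mul_assoc, ih, add_mul, smul_mul_assoc, mul_assoc, mul_assoc,
        mul_eq_qBracket h1 x y, h]
      simp only [mul_add, mul_smul_comm, ← mul_assoc, hw, hw', smul_add, smul_mul_assoc,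
        add_sub_cancel_right]
      have e : q ^ n * qNum q 1 + q⁻¹ * zNum q n = zNum q (n + 1) := by
        simp only [qNum, zNum, zpow_neg, zpow_add₀ hq0, zpow_one]
        have := zpow_ne_zero n hq0
        field_simp; ring
      rw [← e]
      simp only [zpow_add₀ hq0, zpow_one]
      module

/-! ### The transition matrix for a Serre pair -/

/-- The monomial `y^(s) [x,y]_q^(k) x^(p)` in divided powers. -/
def triMon (q : K) (x y : A) (s k p : ℤ) : A :=
  divPow q y s * divPow q (qBracket q x y) k * divPow q x p

/-- The coefficient of `r` without the constraints on the indices, for integer arguments. -/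
def rRaw (q : K) (b : ℕ) (a c n₁ n₂ n₃ : ℤ) : K :=
  q ^ ((a - n₂) * (c - n₂)) / qPoch q b * polyP q b (q ^ (2 * n₁)) (q ^ (2 * n₂)) (q ^ (2 * n₃))

/-- A shift of the summation index when both boundary terms vanish. -/
theorem sum_range_shift {B : Type*} [AddCommGroup B] (g : ℕ → B) (M : ℕ) (h0 : g 0 = 0)
    (hM : g M = 0) : ∑ k ∈ Finset.range M, g (k + 1) = ∑ k ∈ Finset.range M, g k := by
  have h1 := Finset.sum_range_succ' g M
  rw [Finset.sum_range_succ, hM, h0] at h1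
  simpa using h1.symm

section

variable {q : K} (hq0 : q ≠ 0) (hq : ∀ n : ℕ, 0 < n → q ^ n ≠ 1) {x y : A}
  (h : IsSerrePair q x y)
include hq0 hq h

theorem mul_triMon (s k p : ℤ) :
    x * triMon q x y s k p = (q ^ (s - k) * zNum q (p + 1)) • triMon q x y s k (p + 1) +
      zNum q (k + 1) • triMon q x y (s - 1) (k + 1) p := by
  have h1 := qNum_ne_zero hq0 hq one_pos
  have hxw := (mul_qBracket_iff hq0 h1 x y).mpr h.left
  have hwy := (qBracket_mul_iff hq0 h1 x y).mpr h.right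
  have e1 := scalar_comm_divPow q hxw k
  unfold triMon
  rw [← mul_assoc, ← mul_assoc, mul_divPow_qBracket hq0 hq hwy, add_mul, add_mul,
    mul_assoc (divPow q y (s - 1)), mul_divPow hq0 hq, smul_mul_assoc, mul_assoc _ x, e1,
    mul_smul_comm, smul_mul_assoc, smul_mul_assoc, mul_assoc, mul_assoc, mul_divPow hq0 hq,
    mul_smul_comm, mul_smul_comm, smul_smul, smul_smul, mul_smul_comm, smul_mul_assoc,
    zpow_sub₀ hq0, inv_zpow, mul_assoc, mul_assoc, div_eq_mul_inv]
  simp only [mul_assoc]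

/-- The case without `[y,x]_q`: reordering `x^(a) y^(c)`. -/
theorem divPow_mul_divPow (a : ℕ) (c : ℤ) (M : ℕ) (hM : a < M) :
    divPow q x a * divPow q y c =
      ∑ k ∈ Finset.range M, q ^ (((a : ℤ) - k) * (c - k)) • triMon q x y (c - k) k (a - k) := by
  induction a with
  | zero =>
    rw [Finset.sum_eq_single 0]
    · simp [triMon, divPow_zero]
    · intro k _ hk
      rw [triMon, divPow_of_neg q x (by omega)]; simp
    · intro h'; simp at h'; omega
  | succ a ih =>
    have hz : zNum q (a + 1) ≠ 0 := by
      rw [← Nat.cast_succ, ← qNum_eq_zNum]; exact qNum_ne_zero hq0 hq (Nat.succ_pos _)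
    apply smul_right_injective A hz
    show zNum q (a + 1) • (_ * _) = zNum q (a + 1) • _
    rw [Nat.cast_succ, ← smul_mul_assoc, ← mul_divPow hq0 hq, mul_assoc, ih (by omega),
      Finset.mul_sum]
    simp only [mul_smul_comm, mul_triMon hq0 hq h, smul_add, smul_smul]
    rw [Finset.sum_add_distrib]
    -- The second terms of `mul_triMon`, reindexed; they vanish at both ends of the range.
    let g : ℕ → A := fun k => (q ^ (((a : ℤ) - k + 1) * (c - k + 1)) * zNum q k) •
      triMon q x y (c - k) k (a + 1 - k)
    have hg : ∀ k : ℕ, (q ^ (((a : ℤ) - k) * (c - k)) * zNum q (k + 1)) •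
        triMon q x y (c - k - 1) (k + 1) (a - k) = g (k + 1) := by
      intro k
      simp only [g]
      push_cast
      congr 2 <;> ring_nf
    simp only [hg]
    rw [sum_range_shift g M (by simp [g, zNum_zero])
      (by simp only [g, triMon]; rw [divPow_of_neg q x (by omega)]; simp), Finset.smul_sum,
      ← Finset.sum_add_distrib]
    refine Finset.sum_congr rfl fun k _ => ?_
    simp only [g]
    rw [show (a : ℤ) - k + 1 = a + 1 - k by ring, ← add_smul, smul_smul]
    congr 1
    have e1 : q ^ (((a : ℤ) - k) * (c - k)) * (q ^ (c - k - k)) =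
        q ^ (((a : ℤ) + 1 - k) * (c - k)) * q ^ (-(k : ℤ)) := by
      rw [← zpow_add₀ hq0, ← zpow_add₀ hq0]; congr 1; ring
    have e2 : q ^ (((a : ℤ) + 1 - k) * (c - k + 1)) =
        q ^ (((a : ℤ) + 1 - k) * (c - k)) * q ^ ((a : ℤ) + 1 - k) := by
      rw [← zpow_add₀ hq0]; congr 1; ring
    rw [← mul_assoc, e1, e2]
    simp only [zNum, zpow_neg, zpow_add₀ hq0, zpow_sub₀ hq0, zpow_one]
    have h2 := zpow_ne_zero (k : ℤ) hq0
    have h3 := zpow_ne_zero (a : ℤ) hq0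
    field_simp
    ring

/-- Left multiplication by `[y,x]_q = q (y x - [x,y]_q)`. -/
theorem qBracket_swap_mul_triMon (s k p : ℤ) :
    qBracket q y x * triMon q x y s k p =
      (q ^ (s + 1 - k) * zNum q (s + 1) * zNum q (p + 1)) • triMon q x y (s + 1) k (p + 1) -
      (q ^ (s + 1) * zNum q (k + 1)) • triMon q x y s (k + 1) p := by
  have h1 := qNum_ne_zero hq0 hq one_pos
  have hxw := (mul_qBracket_iff hq0 h1 x y).mpr h.left
  have hyw := (mul_qBracket_iff hq0 h1 y x).mpr h.right
  have hwy : qBracket q y x * y = q • (y * qBracket q y x) := by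
    rw [hyw, smul_smul, mul_inv_cancel₀ hq0, one_smul]
  have hw : qBracket q y x = q • (y * x - qBracket q x y) := by
    apply smul_right_injective A h1
    show qNum q 1 • _ = qNum q 1 • _
    rw [qNum_one_smul_qBracket h1, smul_comm, smul_sub, qNum_one_smul_qBracket h1]
    simp only [qNum, pow_one]
    have : q * (q⁻¹ - q) = 1 - q * q := by field_simp
    rw [smul_sub, smul_smul, this]
    module
  have e1 := scalar_comm_divPow q hxw k
  unfold triMon
  rw [← mul_assoc, ← mul_assoc, scalar_comm_divPow q hwy, hw, mul_smul_comm, smul_smul, mul_sub,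
    smul_mul_assoc, smul_mul_assoc, sub_mul, sub_mul, ← mul_assoc (divPow q y s) y,
    divPow_mul hq0 hq, mul_assoc _ x, e1, mul_assoc _ (qBracket q x y), mul_divPow hq0 hq]
  simp only [smul_mul_assoc, mul_smul_comm, mul_assoc, mul_divPow hq0 hq, smul_sub, smul_smul,
    inv_zpow]
  rw [zpow_sub₀ hq0, zpow_add₀ hq0, zpow_one, div_eq_mul_inv]
  congr 2 <;> ring

omit h [Ring A] [Algebra K A] in
/-- The recursion defining the polynomials `P_m`, in terms of the coefficients of `r`. -/
theorem rRaw_succ (b : ℕ) (a c n₁ n₂ n₃ : ℤ) (h₁ : a + (b + 1) = n₁ + n₂)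
    (h₂ : b + 1 + c = n₂ + n₃) :
    q ^ (-a) * zNum q (b + 1) * rRaw q (b + 1) a c n₁ n₂ n₃ =
      q ^ (n₃ - n₂) * zNum q n₃ * zNum q n₁ * rRaw q b a c (n₁ - 1) n₂ (n₃ - 1) -
      q ^ (n₃ + 1) * zNum q n₂ * rRaw q b a c n₁ (n₂ - 1) n₃ := by
  have hs : ∀ n : ℤ, q ^ (2 * (n - 1)) = q ^ (2 * n) / q ^ 2 := by
    intro n; rw [mul_sub, zpow_sub₀ hq0]; norm_cast
  have hP : qPoch q (b + 1) = qPoch q b * (1 - q ^ (2 * (b + 1))) := Finset.prod_range_succ _ _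
  have hP0 : ∀ m, qPoch q m ≠ 0 := fun m =>
    Finset.prod_ne_zero_iff.mpr fun k _ => sub_ne_zero.mpr (hq _ (by omega)).symm
  have hP1 : 1 - q ^ (2 * (b + 1)) ≠ 0 := sub_ne_zero.mpr (hq _ (by omega)).symm
  have hz : ∀ n : ℤ, zNum q n = q ^ (-n) * (1 - q ^ (2 * n)) := by
    intro n; rw [zNum, mul_sub, ← zpow_add₀ hq0, mul_one]; congr 2; ring
  have hb : zNum q (b + 1) = q ^ (-((b : ℤ) + 1)) * (1 - q ^ (2 * (b + 1))) := by
    rw [hz]; norm_cast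
  simp only [rRaw, hs, polyP, hP]
  rw [hb, hz n₁, hz n₂, hz n₃]
  have h2b : q ^ (2 * n₁) * q ^ (2 * n₃) / q ^ (2 * b) = q ^ (2 * n₁ + 2 * n₃ - 2 * b) := by
    rw [zpow_sub₀ hq0, zpow_add₀ hq0]; norm_cast
  rw [h2b]
  set p₁ := polyP q b (q ^ (2 * n₁) / q ^ 2) (q ^ (2 * n₂)) (q ^ (2 * n₃) / q ^ 2)
  set p₂ := polyP q b (q ^ (2 * n₁)) (q ^ (2 * n₂) / q ^ 2) (q ^ (2 * n₃))
  have e1 : q ^ (n₃ - n₂) * q ^ (-n₃) * q ^ (-n₁) = q ^ (-a) * q ^ (-((b : ℤ) + 1)) := by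
    simp only [← zpow_add₀ hq0]; congr 1; linear_combination h₁
  have e2 : q ^ (n₃ + 1) * q ^ (-n₂) * q ^ ((a - (n₂ - 1)) * (c - (n₂ - 1))) =
      q ^ (-a) * q ^ (-((b : ℤ) + 1)) * q ^ ((a - n₂) * (c - n₂)) *
        q ^ (2 * n₁ + 2 * n₃ - 2 * b) := by
    simp only [← zpow_add₀ hq0]; congr 1; linear_combination 2 * h₁ + h₂
  have := hP0 b
  calc _ = q ^ (-a) * q ^ (-((b : ℤ) + 1)) * q ^ ((a - n₂) * (c - n₂)) / qPoch q b *
      ((1 - q ^ (2 * n₁)) * (1 - q ^ (2 * n₃)) * p₁) -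
      q ^ (-a) * q ^ (-((b : ℤ) + 1)) * q ^ ((a - n₂) * (c - n₂)) *
        q ^ (2 * n₁ + 2 * n₃ - 2 * b) / qPoch q b * ((1 - q ^ (2 * n₂)) * p₂) := by
        field_simp
    _ = _ := by rw [← e2, ← e1]; ring

/-- The matrix `r`, with entries written as `rRaw`, is the transition matrix between the
two orderings of the monomials in a Serre pair and its `q`-brackets. Any
sufficiently long range of summation is allowed, since `triMon` vanishes as soon as one exponent is negative. -/
theorem divPow_mul_swap (a b : ℕ) (c : ℤ) (M : ℕ) (hM : a + b < M) :
    divPow q x a * divPow q (qBracket q y x) b * divPow q y c =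
      ∑ k ∈ Finset.range M, rRaw q b a c (a + b - k) k (b + c - k) •
        triMon q x y (b + c - k) k (a + b - k) := by
  induction b with
  | zero =>
    rw [Nat.cast_zero, divPow_zero, mul_one, divPow_mul_divPow hq0 hq h a c M hM]
    simp [rRaw, polyP, qPoch]
  | succ b ih =>
    have h1 := qNum_ne_zero hq0 hq one_pos
    have hwx := (qBracket_mul_iff hq0 h1 y x).mpr h.left
    have hz : q ^ (-(a : ℤ)) * zNum q (b + 1) ≠ 0 := by
      rw [← Nat.cast_succ, ← qNum_eq_zNum]
      exact mul_ne_zero (zpow_ne_zero _ hq0) (qNum_ne_zero hq0 hq (Nat.succ_pos _))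
    apply smul_right_injective A hz
    have e1 := congrArg (qBracket q y x * ·) (ih (by omega))
    simp only [← mul_assoc] at e1
    rw [scalar_comm_divPow q hwx, smul_mul_assoc, mul_assoc _ (qBracket q y x),
      mul_divPow hq0 hq, mul_smul_comm, smul_smul, smul_mul_assoc, inv_zpow'] at e1
    show (q ^ (-(a : ℤ)) * zNum q (b + 1)) • _ = (q ^ (-(a : ℤ)) * zNum q (b + 1)) • _
    push_cast
    rw [e1, Finset.mul_sum]
    simp only [mul_smul_comm, qBracket_swap_mul_triMon hq0 hq h, smul_sub, smul_smul]
    rw [Finset.sum_sub_distrib]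
    let g : ℕ → A := fun k => (rRaw q b a c (a + (b + 1) - k) (k - 1) (b + 1 + c - k) *
      (q ^ ((b : ℤ) + 1 + c - k + 1) * zNum q k)) •
      triMon q x y (b + 1 + c - k) k (a + (b + 1) - k)
    have hg : ∀ k : ℕ, (rRaw q b a c (a + b - k) k (b + c - k) *
        (q ^ ((b : ℤ) + c - k + 1) * zNum q (k + 1))) •
        triMon q x y (b + c - k) (k + 1) (a + b - k) = g (k + 1) := by
      intro k
      simp only [g]
      push_cast
      rw [show (b : ℤ) + 1 + c - (k + 1) = b + c - k by ring,
        show (a : ℤ) + (b + 1) - (k + 1) = a + b - k by ring, add_sub_cancel_right]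
    simp only [hg]
    rw [sum_range_shift g M (by simp [g, zNum_zero])
      (by simp only [g, triMon]; rw [divPow_of_neg q x (by omega)]; simp), Finset.smul_sum,
      ← Finset.sum_sub_distrib]
    refine Finset.sum_congr rfl fun k _ => ?_
    simp only [g]
    rw [show (b : ℤ) + c - k + 1 = b + 1 + c - k by ring,
      show (a : ℤ) + b - k + 1 = a + (b + 1) - k by ring, ← sub_smul, smul_smul,
      rRaw_succ hq0 hq b a c _ _ _ (by ring) (by ring)]
    congr 1
    rw [show (a : ℤ) + (b + 1) - k - 1 = a + b - k by ring,
      show (b : ℤ) + 1 + c - k - 1 = b + c - k by ring]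
    ring

end

/-! ### Transposed operators on the Fock space -/

/-- The operators `S` and `S'` are transposes of each other in the standard basis. -/
def IsTranspose (S S' : Module.End K (Fock6 K)) : Prop :=
  ∀ m n, matElem S m n = matElem S' n m

theorem end_apply_eq_sum (S : Module.End K (Fock6 K)) (v : Fock6 K) (m : Fin 6 → ℕ) :
    S v m = v.sum fun k a => a * matElem S m k := by
  conv_lhs => rw [← Finsupp.sum_single v]
  rw [map_finsuppSum, Finsupp.sum_apply]
  refine Finsupp.sum_congr fun k _ => ?_
  rw [← mul_one (v k), ← smul_eq_mul, ← Finsupp.smul_single, map_smul, Finsupp.smul_apply]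
  simp [matElem]

theorem IsTranspose.mul {S S' U U' : Module.End K (Fock6 K)} (hS : IsTranspose S S')
    (hU : IsTranspose U U') : IsTranspose (S * U) (U' * S') := by
  intro m n
  change S (U (Finsupp.single n 1)) m = U' (S' (Finsupp.single m 1)) n
  rw [end_apply_eq_sum, end_apply_eq_sum]
  set v := U (Finsupp.single n 1) with hv
  set w := S' (Finsupp.single m 1) with hw
  have hv' : ∀ k, matElem U' n k = v k := fun k => (hU k n).symm
  have hw' : ∀ k, matElem S m k = w k := fun k => hS m k
  simp only [hv', hw']
  classical
  rw [Finsupp.sum_of_support_subset v (Finset.subset_union_left (s₂ := w.support)) _ (by simp),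
    Finsupp.sum_of_support_subset w (Finset.subset_union_right (s₁ := v.support)) _ (by simp)]
  exact Finset.sum_congr rfl fun k _ => mul_comm _ _

/-- The index `m` with the entries `i, j, k` replaced by `a, b, c`. -/
def updThree (i j k : Fin 6) (m : Fin 6 → ℕ) (a b c : ℕ) : Fin 6 → ℕ :=
  Function.update (Function.update (Function.update m i a) j b) k c

/-- The row of index `m` of `r_{ijk}`, as a finite sum over the value `t` of the `j`-th
entry. The other two entries are then determined by the conservation laws. -/
noncomputable def rRow (q : K) (i j k : Fin 6) (m : Fin 6 → ℕ) : Fock6 K :=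
  ∑ t ∈ Finset.range (m i + m j + 1), if t ≤ m j + m k then
    rCoeff q (m i) (m j) (m k) (m i + m j - t) t (m j + m k - t) •
      Finsupp.single (updThree i j k m (m i + m j - t) t (m j + m k - t)) 1
  else 0

/-- The transpose of `r_{ijk}`. -/
noncomputable def rTr (q : K) (i j k : Fin 6) : Module.End K (Fock6 K) :=
  Finsupp.linearCombination K (rRow q i j k)

theorem rTr_single (q : K) (i j k : Fin 6) (m : Fin 6 → ℕ) :
    rTr q i j k (Finsupp.single m 1) = rRow q i j k m := by
  simp [rTr]

theorem matElem_rOp (q : K) (i j k : Fin 6) (m n : Fin 6 → ℕ) :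
    matElem (rOp q i j k) m n = rEntry q i j k m n := by
  simp only [matElem, rOp, Finsupp.linearCombination_single, one_smul]
  rfl

section

variable {i j k : Fin 6} (hij : i ≠ j) (hik : i ≠ k) (hjk : j ≠ k)
include hij hik hjk

theorem updThree_eq_iff (m n : Fin 6 → ℕ) (a b c : ℕ) :
    updThree i j k m a b c = n ↔
      (n i = a ∧ n j = b ∧ n k = c) ∧ ∀ s, s ≠ i → s ≠ j → s ≠ k → m s = n s := by
  constructor
  · rintro rfl
    refine ⟨⟨?_, ?_, ?_⟩, fun s h1 h2 h3 => ?_⟩ <;>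
      simp [updThree, *]
  · rintro ⟨⟨rfl, rfl, rfl⟩, h⟩
    funext s
    simp only [updThree, Function.update_apply]
    split_ifs with h1 h2 h3
    · rw [h1]
    · rw [h2]
    · rw [h3]
    · exact h s h3 h2 h1

theorem rRow_apply (q : K) (m n : Fin 6 → ℕ) : rRow q i j k m n = rEntry q i j k m n := by
  rw [rRow, Finsupp.finsetSum_apply]
  have key : ∀ t, (if t ≤ m j + m k then
      rCoeff q (m i) (m j) (m k) (m i + m j - t) t (m j + m k - t) •
        Finsupp.single (updThree i j k m (m i + m j - t) t (m j + m k - t)) (1 : K)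
      else 0) n = if (t ≤ m j + m k ∧ n i = m i + m j - t ∧ n j = t ∧ n k = m j + m k - t) ∧
        ∀ s, s ≠ i → s ≠ j → s ≠ k → m s = n s then
        rCoeff q (m i) (m j) (m k) (n i) (n j) (n k) else 0 := by
    intro t
    by_cases ht : t ≤ m j + m k
    · rw [if_pos ht, Finsupp.smul_apply, Finsupp.single_apply]
      by_cases hu : updThree i j k m (m i + m j - t) t (m j + m k - t) = n
      · rw [if_pos hu]
        have hu' := (updThree_eq_iff hij hik hjk m n _ _ _).mp hu
        rw [if_pos ⟨⟨ht, hu'.1⟩, hu'.2⟩, ← hu'.1.1, ← hu'.1.2.2, hu'.1.2.1]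
        simp
      · rw [if_neg hu, if_neg]
        · simp
        · exact fun h => hu ((updThree_eq_iff hij hik hjk m n _ _ _).mpr ⟨h.1.2, h.2⟩)
    · rw [if_neg ht, if_neg fun h => ht h.1.1]; rfl
  rw [Finset.sum_congr rfl fun t _ => key t, rEntry]
  by_cases hs : ∀ s, s ≠ i → s ≠ j → s ≠ k → m s = n s
  swap
  · rw [if_neg hs]
    exact Finset.sum_eq_zero fun t _ => if_neg fun h => hs h.2
  rw [if_pos hs]
  by_cases hc : m i + m j = n i + n j ∧ m j + m k = n j + n k
  · rw [Finset.sum_eq_single (n j)]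
    · rw [if_pos ⟨⟨by omega, by omega, rfl, by omega⟩, hs⟩]
    · exact fun t _ ht => if_neg fun h => ht h.1.2.2.1.symm
    · intro h; simp at h; omega
  · rw [rCoeff, if_neg hc]
    exact Finset.sum_eq_zero fun t _ => by simp

theorem isTranspose_rOp (q : K) : IsTranspose (rOp q i j k) (rTr q i j k) := by
  intro m n
  rw [matElem_rOp, ← rRow_apply hij hik hjk, matElem, rTr_single]

/-- If two families of monomials differ by the exchange of the two orderings of a Serre pair in
the positions `i, j, k`, then the transpose of `r_{ijk}` relates them. -/
theorem linearCombination_rTr {q : K} (hq0 : q ≠ 0) (hq : ∀ n : ℕ, 0 < n → q ^ n ≠ 1) {x y w w' : A}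
    (h : IsSerrePair q x y) (hw : qBracket q x y = w) (hw' : qBracket q y x = w')
    (X Z V W : (Fin 6 → ℕ) → A)
    (hX : ∀ m n, (∀ s, s ≠ i → s ≠ j → s ≠ k → m s = n s) → X m = X n)
    (hZ : ∀ m n, (∀ s, s ≠ i → s ≠ j → s ≠ k → m s = n s) → Z m = Z n)
    (hV : ∀ m, V m =
      X m * (divPow q x (m i) * divPow q w' (m j) * divPow q y (m k)) * Z m)
    (hW : ∀ n, W n =
      X n * (divPow q y (n k) * divPow q w (n j) * divPow q x (n i)) * Z n) :
    Finsupp.linearCombination K V = Finsupp.linearCombination K W ∘ₗ rTr q i j k := by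
  subst hw hw'
  ext m
  simp only [LinearMap.comp_apply, Finsupp.lsingle_apply]
  rw [rTr_single, Finsupp.linearCombination_single, one_smul, hV,
    divPow_mul_swap hq0 hq h (m i) (m j) (m k) (m i + m j + 1) (Nat.lt_succ_self _), rRow, map_sum,
    Finset.mul_sum, Finset.sum_mul]
  refine Finset.sum_congr rfl fun t ht => ?_
  have ht' : t ≤ m i + m j := by simpa [Nat.lt_succ_iff] using ht
  rw [apply_ite (Finsupp.linearCombination K W), map_zero, map_smul,
    Finsupp.linearCombination_single, one_smul]
  split_ifs with htc
  · set n := updThree i j k m (m i + m j - t) t (m j + m k - t) with hn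
    obtain ⟨⟨h1, h2, h3⟩, hs⟩ := (updThree_eq_iff hij hik hjk m n _ _ _).mp hn.symm
    rw [hW, ← hX m n hs, ← hZ m n hs, triMon, mul_smul_comm, smul_mul_assoc]
    have e1 : (n i : ℤ) = m i + m j - t := by omega
    have e3 : (n k : ℤ) = m j + m k - t := by omega
    rw [e1, e3, h2, rCoeff, if_pos ⟨by omega, by omega⟩, rRaw, ← e1, ← e3, ← h1, ← h3]
    norm_cast
  · rw [triMon, divPow_of_neg q y (by omega)]; simp

end

/-! ### Relations in `B_3` -/

/-- The elements `a, b, c` satisfy the defining relations of `B_3`. -/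
structure IsSerreTriple (q : K) (a b c : A) : Prop where
  ab : IsSerrePair q a b
  bc : IsSerrePair q b c
  ac : Commute a c

theorem IsSerreTriple.symm {q : K} {a b c : A} (h : IsSerreTriple q a b c) :
    IsSerreTriple q c b a :=
  ⟨h.bc.symm, h.ab.symm, h.ac.symm⟩

theorem qBracket_left_comm (q : K) {a c : A} (b : A) (h : Commute a c) :
    qBracket q a (qBracket q c b) = qBracket q c (qBracket q a b) := by
  have h1 : c * a = a * c := h.eq.symm
  have h2 : ∀ z, c * (a * z) = a * (c * z) := fun z => by rw [← mul_assoc, h1, mul_assoc]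
  simp only [qBracket, mul_sub, sub_mul, smul_sub, mul_smul_comm, smul_mul_assoc, mul_assoc, h1, h2]
  module

theorem qBracket_assoc (q : K) {a c : A} (b : A) (h : Commute a c) :
    qBracket q (qBracket q a b) c = qBracket q a (qBracket q b c) := by
  have h1 : c * a = a * c := h.eq.symm
  have h2 : ∀ z, c * (a * z) = a * (c * z) := fun z => by rw [← mul_assoc, h1, mul_assoc]
  simp only [qBracket, mul_sub, sub_mul, smul_sub, mul_smul_comm, smul_mul_assoc, mul_assoc, h1, h2]
  module

theorem qBracket_right_comm (q : K) {a c : A} (b : A) (h : Commute a c) :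
    qBracket q (qBracket q b a) c = qBracket q (qBracket q b c) a := by
  have h1 : c * a = a * c := h.eq.symm
  have h2 : ∀ z, c * (a * z) = a * (c * z) := fun z => by rw [← mul_assoc, h1, mul_assoc]
  simp only [qBracket, mul_sub, sub_mul, smul_sub, mul_smul_comm, smul_mul_assoc, mul_assoc, h1, h2]
  module

/-- Bracketing with an element that commutes with `a` preserves a relation quadratic in `a`. -/
theorem serre_qBracket_right {q : K} {a b c : A}
    (h : a ^ 2 * b + b * a ^ 2 = (q⁻¹ + q) • (a * b * a)) (hac : Commute a c) :
    a ^ 2 * qBracket q b c + qBracket q b c * a ^ 2 = (q⁻¹ + q) • (a * qBracket q b c * a) := by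
  have h1 : c * a = a * c := hac.eq.symm
  have h2 : ∀ z, c * (a * z) = a * (c * z) := fun z => by rw [← mul_assoc, h1, mul_assoc]
  have e1 := congrArg (· * c) h
  have e2 := congrArg (c * ·) h
  simp only [qBracket, mul_sub, sub_mul, smul_sub, mul_smul_comm, smul_mul_assoc, mul_assoc, h1, h2,
    pow_two, mul_add, add_mul] at e1 e2 ⊢
  linear_combination (norm := module) (qNum q 1)⁻¹ • e1 - (qNum q 1)⁻¹ • q • e2

theorem serre_qBracket_left {q : K} {a b c : A}
    (h : a ^ 2 * b + b * a ^ 2 = (q⁻¹ + q) • (a * b * a)) (hac : Commute a c) :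
    a ^ 2 * qBracket q c b + qBracket q c b * a ^ 2 = (q⁻¹ + q) • (a * qBracket q c b * a) := by
  have h1 : c * a = a * c := hac.eq.symm
  have h2 : ∀ z, c * (a * z) = a * (c * z) := fun z => by rw [← mul_assoc, h1, mul_assoc]
  have e1 := congrArg (· * c) h
  have e2 := congrArg (c * ·) h
  simp only [qBracket, mul_sub, sub_mul, smul_sub, mul_smul_comm, smul_mul_assoc, mul_assoc, h1, h2,
    pow_two, mul_add, add_mul] at e1 e2 ⊢
  linear_combination (norm := module) (qNum q 1)⁻¹ • e2 - (qNum q 1)⁻¹ • q • e1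

section

variable {q : K} (hq0 : q ≠ 0) (hq : ∀ n : ℕ, 0 < n → q ^ n ≠ 1) {a b c : A}
  (h : IsSerreTriple q a b c)

include hq0 hq in
theorem inv_add_self_ne_zero : q⁻¹ + q ≠ 0 := by
  intro h0
  have h2 : q ^ 2 = -1 := by field_simp at h0; linear_combination h0
  exact hq 4 (by norm_num) (by linear_combination (q ^ 2 - 1) * h2)

include hq0 hq h

/-- This and the next two lemmas are identities of degree `(1, 2, 1)`: the words `a b c b`,
`b c b a`, `c b a b`, `b a b c` are eliminated by the Serre relations, after
multiplication by `q⁻¹ + q`. -/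
theorem IsSerreTriple.commute_qBracket_qBracket : Commute (qBracket q a (qBracket q b c)) b := by
  have h1 : c * a = a * c := h.ac.eq.symm
  have h2 : ∀ z, c * (a * z) = a * (c * z) := fun z => by rw [← mul_assoc, h1, mul_assoc]
  have e1 := congrArg (a * ·) h.bc.left
  have e2 := congrArg (· * a) h.bc.left
  have e3 := congrArg (c * ·) h.ab.right
  have e4 := congrArg (· * c) h.ab.right
  apply smul_right_injective A (inv_add_self_ne_zero hq0 hq)
  show (q⁻¹ + q) • (_ * _) = (q⁻¹ + q) • (_ * _)
  simp only [qBracket, mul_sub, sub_mul, smul_sub, mul_smul_comm, smul_mul_assoc, mul_assoc, h1, h2,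
    pow_two, mul_add, add_mul] at e1 e2 e3 e4 ⊢
  linear_combination (norm := (match_scalars <;> field_simp <;> ring)) (qNum q 1)⁻¹ • (qNum q 1)⁻¹ •
    (-e1 + q ^ 2 • e2 - q ^ 2 • e3 + e4)

theorem IsSerreTriple.commute_qBracket_left : Commute (qBracket q a b) (qBracket q c b) := by
  have h1 : c * a = a * c := h.ac.eq.symm
  have h2 : ∀ z, c * (a * z) = a * (c * z) := fun z => by rw [← mul_assoc, h1, mul_assoc]
  have e1 := congrArg (a * ·) h.bc.left
  have e2 := congrArg (· * a) h.bc.left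
  have e3 := congrArg (c * ·) h.ab.right
  have e4 := congrArg (· * c) h.ab.right
  apply smul_right_injective A (inv_add_self_ne_zero hq0 hq)
  show (q⁻¹ + q) • (_ * _) = (q⁻¹ + q) • (_ * _)
  simp only [qBracket, mul_sub, sub_mul, smul_sub, mul_smul_comm, smul_mul_assoc, mul_assoc, h1, h2,
    pow_two, mul_add, add_mul] at e1 e2 e3 e4 ⊢
  linear_combination (norm := (match_scalars <;> field_simp <;> ring)) (qNum q 1)⁻¹ • (qNum q 1)⁻¹ •
    (-e1 + q ^ 2 • e2 + e3 - q ^ 2 • e4)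

theorem IsSerreTriple.commute_qBracket_right : Commute (qBracket q b a) (qBracket q b c) := by
  have h1 : c * a = a * c := h.ac.eq.symm
  have h2 : ∀ z, c * (a * z) = a * (c * z) := fun z => by rw [← mul_assoc, h1, mul_assoc]
  have e1 := congrArg (a * ·) h.bc.left
  have e2 := congrArg (· * a) h.bc.left
  have e3 := congrArg (c * ·) h.ab.right
  have e4 := congrArg (· * c) h.ab.right
  apply smul_right_injective A (inv_add_self_ne_zero hq0 hq)
  show (q⁻¹ + q) • (_ * _) = (q⁻¹ + q) • (_ * _)
  simp only [qBracket, mul_sub, sub_mul, smul_sub, mul_smul_comm, smul_mul_assoc, mul_assoc, h1, h2,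
    pow_two, mul_add, add_mul] at e1 e2 e3 e4 ⊢
  linear_combination (norm := (match_scalars <;> field_simp <;> ring)) (qNum q 1)⁻¹ • (qNum q 1)⁻¹ •
    (-(q ^ 2 • e1) + e2 + q ^ 2 • e3 - e4)

/-- The second Serre relation holds because `[a,[b,c]_q]_q` commutes with `b` and `q`-commutes
with `c`. -/
theorem IsSerreTriple.serrePair_qBracket_right : IsSerrePair q a (qBracket q b c) := by
  have hn := qNum_ne_zero hq0 hq one_pos
  refine ⟨serre_qBracket_right h.ab.left h.ac, (qBracket_mul_iff hq0 hn _ _).mp ?_⟩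
  have hb := (h.commute_qBracket_qBracket hq0 hq).eq
  have hc := (qBracket_mul_iff hq0 hn (qBracket q a b) c).mpr
    (serre_qBracket_left h.bc.right h.ac.symm)
  rw [qBracket_assoc q b h.ac] at hc
  set z := qBracket q a (qBracket q b c)
  have e1 : z * (b * c) = q⁻¹ • (b * c * z) := by
    rw [← mul_assoc, hb, mul_assoc, hc, mul_smul_comm, mul_assoc]
  have e2 : z * (c * b) = q⁻¹ • (c * b * z) := by
    rw [← mul_assoc, hc, smul_mul_assoc, mul_assoc, hb, mul_assoc]
  rw [qBracket, mul_smul_comm, smul_mul_assoc, mul_sub, sub_mul, mul_smul_comm, smul_mul_assoc,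
    e1, e2]
  module

theorem IsSerreTriple.serrePair_qBracket_left : IsSerrePair q a (qBracket q c b) := by
  have hn := qNum_ne_zero hq0 hq one_pos
  refine ⟨serre_qBracket_left h.ab.left h.ac, (mul_qBracket_iff hq0 hn _ _).mp ?_⟩
  have hb := (h.symm.commute_qBracket_qBracket hq0 hq).eq
  have hc := (mul_qBracket_iff hq0 hn c (qBracket q b a)).mpr
    (serre_qBracket_right h.bc.right h.ac.symm)
  rw [qBracket_assoc q b h.ac.symm]
  set z := qBracket q c (qBracket q b a)
  have e1 : c * b * z = q⁻¹ • (z * (c * b)) := by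
    rw [mul_assoc, ← hb, ← mul_assoc, hc, smul_mul_assoc, mul_assoc]
  have e2 : b * c * z = q⁻¹ • (z * (b * c)) := by
    rw [mul_assoc, hc, mul_smul_comm, ← mul_assoc, ← hb, mul_assoc]
  rw [qBracket, mul_smul_comm, smul_mul_assoc, mul_sub, sub_mul, mul_smul_comm, smul_mul_assoc,
    e1, e2]
  module

end

/-! ### The two chains of reorderings -/

/-- The monomial `E_n`, for elements `a, b, c` in place of `e_1, e_2, e_3`, integer exponents. -/
def monE (q : K) (a b c : A) (n₁ n₂ n₃ n₄ n₅ n₆ : ℤ) : A :=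
  divPow q c n₆ * divPow q (qBracket q b c) n₅ * divPow q (qBracket q a (qBracket q b c)) n₄ *
    divPow q b n₃ * divPow q (qBracket q a b) n₂ * divPow q a n₁

/-- The monomial `Ẽ_m`, for elements `a, b, c` in place of `e_1, e_2, e_3`. -/
def monEt (q : K) (a b c : A) (m₁ m₂ m₃ m₄ m₅ m₆ : ℤ) : A :=
  divPow q a m₁ * divPow q (qBracket q b a) m₂ * divPow q (qBracket q (qBracket q c b) a) m₄ *
    divPow q b m₃ * divPow q (qBracket q c b) m₅ * divPow q c m₆

/-- Composition of four factorisations, stated for opaque maps because comparing the concrete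
composites by unfolding is expensive. -/
theorem comp_chain {M N : Type*} [AddCommGroup M] [Module K M] [AddCommGroup N] [Module K N]
    {f₀ f₁ f₂ f₃ f₄ : M →ₗ[K] N} {g₁ g₂ g₃ g₄ : Module.End K M} (h₁ : f₀ = f₁ ∘ₗ g₁)
    (h₂ : f₁ = f₂ ∘ₗ g₂) (h₃ : f₂ = f₃ ∘ₗ g₃) (h₄ : f₃ = f₄ ∘ₗ g₄) :
    f₀ = f₄ ∘ₗ (g₄ * (g₃ * (g₂ * g₁))) := by
  rw [h₁, h₂, h₃, h₄]; rfl

section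

variable {q : K} (hq0 : q ≠ 0) (hq : ∀ n : ℕ, 0 < n → q ^ n ≠ 1) {a b c : A}
  (h : IsSerreTriple q a b c)
include hq0 hq h

/-- Reordering `Ẽ_m` into `E_n` through the Serre pairs `(e_1, e_2)`, `(e_1, ẽ_{23})`,
`(e_{12}, e_3)` and `(e_2, e_3)`, in this order. -/
theorem linearCombination_monEt_T₁ :
    Finsupp.linearCombination K
        (fun m : Fin 6 → ℕ => monEt q a b c (m 0) (m 1) (m 2) (m 3) (m 4) (m 5)) =
      Finsupp.linearCombination K
        (fun n : Fin 6 → ℕ => monE q a b c (n 0) (n 1) (n 2) (n 3) (n 4) (n 5)) ∘ₗ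
      (rTr q 2 4 5 * (rTr q 1 3 5 * (rTr q 0 3 4 * rTr q 0 1 2))) := by
  have hbt : Commute (qBracket q (qBracket q c b) a) b := by
    rw [qBracket_assoc q b h.ac.symm]; exact h.symm.commute_qBracket_qBracket hq0 hq
  have hb := h.commute_qBracket_qBracket hq0 hq
  have hl := h.commute_qBracket_left hq0 hq
  have p2 := h.serrePair_qBracket_left hq0 hq
  have p3 := (h.symm.serrePair_qBracket_left hq0 hq).symm
  have i2 := qBracket_left_comm q b h.ac
  have i3 := qBracket_assoc q b h.ac
  unfold monE monEt
  generalize hab : qBracket q a b = ab at *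
  generalize hba : qBracket q b a = ba at *
  generalize hbc : qBracket q b c = bc at *
  generalize hcb : qBracket q c b = cb at *
  generalize habc : qBracket q a bc = abc at *
  generalize hcba : qBracket q cb a = cba at *
  generalize hf : qBracket q a cb = f at *
  let V1 : (Fin 6 → ℕ) → A := fun m =>
    divPow q b (m 2) * (divPow q ab (m 1) * (divPow q a (m 0) *
      (divPow q cba (m 3) * (divPow q cb (m 4) * divPow q c (m 5)))))
  let V2 : (Fin 6 → ℕ) → A := fun m =>
    divPow q b (m 2) * (divPow q ab (m 1) * (divPow q cb (m 4) * (divPow q f (m 3) *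
      (divPow q a (m 0) * divPow q c (m 5)))))
  let V3 : (Fin 6 → ℕ) → A := fun m =>
    divPow q b (m 2) * (divPow q cb (m 4) * (divPow q c (m 5) * (divPow q abc (m 3) *
      (divPow q ab (m 1) * divPow q a (m 0)))))
  have s1 := linearCombination_rTr (i := 0) (j := 1) (k := 2) (by decide) (by decide) (by decide)
    hq0 hq h.ab hab hba (fun _ => 1)
    (fun m => divPow q cba (m 3) * (divPow q cb (m 4) * divPow q c (m 5)))
    (fun m => divPow q a (m 0) * divPow q ba (m 1) * divPow q cba (m 3) * divPow q b (m 2) *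
      divPow q cb (m 4) * divPow q c (m 5))
    V1 (fun _ _ _ => rfl)
    (fun m n hmn => by simp only [hmn 3 (by decide) (by decide) (by decide),
      hmn 4 (by decide) (by decide) (by decide), hmn 5 (by decide) (by decide) (by decide)])
    (fun m => by simp only [one_mul, mul_assoc, (commute_divPow q hbt (m 3) (m 2)).left_comm])
    (fun m => by simp only [V1, one_mul, mul_assoc])
  have s2 := linearCombination_rTr (i := 0) (j := 3) (k := 4) (by decide) (by decide) (by decide)
    hq0 hq p2 hf hcba (fun m => divPow q b (m 2) * divPow q ab (m 1))
    (fun m => divPow q c (m 5)) V1 V2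
    (fun m n hmn => by simp only [hmn 1 (by decide) (by decide) (by decide),
      hmn 2 (by decide) (by decide) (by decide)])
    (fun m n hmn => by simp only [hmn 5 (by decide) (by decide) (by decide)])
    (fun m => by simp only [V1, mul_assoc]) (fun m => by simp only [V2, mul_assoc])
  have s3 := linearCombination_rTr (i := 1) (j := 3) (k := 5) (by decide) (by decide) (by decide)
    hq0 hq p3 i3 i2.symm (fun m => divPow q b (m 2) * divPow q cb (m 4))
    (fun m => divPow q a (m 0)) V2 V3
    (fun m n hmn => by simp only [hmn 4 (by decide) (by decide) (by decide),
      hmn 2 (by decide) (by decide) (by decide)])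
    (fun m n hmn => by simp only [hmn 0 (by decide) (by decide) (by decide)])
    (fun m => by simp only [V2, mul_assoc, (commute_divPow q hl (m 1) (m 4)).left_comm,
      (commute_divPow q h.ac (m 0) (m 5)).eq])
    (fun m => by simp only [V3, mul_assoc])
  have s4 := linearCombination_rTr (i := 2) (j := 4) (k := 5) (by decide) (by decide) (by decide)
    hq0 hq h.bc hbc hcb (fun _ => 1)
    (fun m => divPow q abc (m 3) * divPow q ab (m 1) * divPow q a (m 0)) V3
    (fun n => divPow q c (n 5) * divPow q bc (n 4) * divPow q abc (n 3) * divPow q b (n 2) *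
      divPow q ab (n 1) * divPow q a (n 0))
    (fun _ _ _ => rfl)
    (fun m n hmn => by simp only [hmn 0 (by decide) (by decide) (by decide),
      hmn 1 (by decide) (by decide) (by decide), hmn 3 (by decide) (by decide) (by decide)])
    (fun m => by simp only [V3, one_mul, mul_assoc])
    (fun m => by simp only [one_mul, mul_assoc, (commute_divPow q hb (m 3) (m 2)).left_comm])
  exact comp_chain s1 s2 s3 s4

/-- Reordering `Ẽ_m` into `E_n` through the Serre pairs `(e_2, e_3)`, `(ẽ_{12}, e_3)`,
`(e_1, e_{23})` and `(e_1, e_2)`, in this order. -/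
theorem linearCombination_monEt_T₂ :
    Finsupp.linearCombination K
        (fun m : Fin 6 → ℕ => monEt q a b c (m 0) (m 1) (m 2) (m 3) (m 4) (m 5)) =
      Finsupp.linearCombination K
        (fun n : Fin 6 → ℕ => monE q a b c (n 0) (n 1) (n 2) (n 3) (n 4) (n 5)) ∘ₗ
      (rTr q 0 1 2 * (rTr q 0 3 4 * (rTr q 1 3 5 * rTr q 2 4 5))) := by
  have hr := h.commute_qBracket_right hq0 hq
  have p2 := (h.symm.serrePair_qBracket_right hq0 hq).symm
  have p3 := h.serrePair_qBracket_right hq0 hq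
  have i2 := qBracket_assoc q b h.ac.symm
  have i3 := qBracket_right_comm q b h.ac
  unfold monE monEt
  generalize hab : qBracket q a b = ab at *
  generalize hba : qBracket q b a = ba at *
  generalize hbc : qBracket q b c = bc at *
  generalize hcb : qBracket q c b = cb at *
  generalize habc : qBracket q a bc = abc at *
  generalize hcba : qBracket q cb a = cba at *
  generalize hf : qBracket q ba c = f at *
  let V1 : (Fin 6 → ℕ) → A := fun m =>
    divPow q a (m 0) * (divPow q ba (m 1) * (divPow q cba (m 3) *
      (divPow q c (m 5) * (divPow q bc (m 4) * divPow q b (m 2)))))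
  let V2 : (Fin 6 → ℕ) → A := fun m =>
    divPow q a (m 0) * (divPow q c (m 5) * (divPow q f (m 3) * (divPow q ba (m 1) *
      (divPow q bc (m 4) * divPow q b (m 2)))))
  let V3 : (Fin 6 → ℕ) → A := fun m =>
    divPow q c (m 5) * (divPow q bc (m 4) * (divPow q abc (m 3) * (divPow q a (m 0) *
      (divPow q ba (m 1) * divPow q b (m 2)))))
  have s1 := linearCombination_rTr (i := 2) (j := 4) (k := 5) (by decide) (by decide) (by decide)
    hq0 hq h.bc hbc hcb
    (fun m => divPow q a (m 0) * (divPow q ba (m 1) * divPow q cba (m 3))) (fun _ => 1)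
    (fun m => divPow q a (m 0) * divPow q ba (m 1) * divPow q cba (m 3) * divPow q b (m 2) *
      divPow q cb (m 4) * divPow q c (m 5))
    V1 (fun m n hmn => by simp only [hmn 0 (by decide) (by decide) (by decide),
      hmn 1 (by decide) (by decide) (by decide), hmn 3 (by decide) (by decide) (by decide)])
    (fun _ _ _ => rfl)
    (fun m => by simp only [mul_one, mul_assoc]) (fun m => by simp only [V1, mul_one, mul_assoc])
  have s2 := linearCombination_rTr (i := 1) (j := 3) (k := 5) (by decide) (by decide) (by decide)
    hq0 hq p2 hf i2.symm (fun m => divPow q a (m 0))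
    (fun m => divPow q bc (m 4) * divPow q b (m 2)) V1 V2
    (fun m n hmn => by simp only [hmn 0 (by decide) (by decide) (by decide)])
    (fun m n hmn => by simp only [hmn 4 (by decide) (by decide) (by decide),
      hmn 2 (by decide) (by decide) (by decide)])
    (fun m => by simp only [V1, mul_assoc]) (fun m => by simp only [V2, mul_assoc])
  have s3 := linearCombination_rTr (i := 0) (j := 3) (k := 4) (by decide) (by decide) (by decide)
    hq0 hq p3 habc i3.symm (fun m => divPow q c (m 5))
    (fun m => divPow q ba (m 1) * divPow q b (m 2)) V2 V3
    (fun m n hmn => by simp only [hmn 5 (by decide) (by decide) (by decide)])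
    (fun m n hmn => by simp only [hmn 1 (by decide) (by decide) (by decide),
      hmn 2 (by decide) (by decide) (by decide)])
    (fun m => by simp only [V2, mul_assoc, (commute_divPow q h.ac (m 0) (m 5)).left_comm,
      (commute_divPow q hr (m 1) (m 4)).left_comm])
    (fun m => by simp only [V3, mul_assoc])
  have s4 := linearCombination_rTr (i := 0) (j := 1) (k := 2) (by decide) (by decide) (by decide)
    hq0 hq h.ab hab hba
    (fun m => divPow q c (m 5) * (divPow q bc (m 4) * divPow q abc (m 3))) (fun _ => 1) V3
    (fun n => divPow q c (n 5) * divPow q bc (n 4) * divPow q abc (n 3) * divPow q b (n 2) *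
      divPow q ab (n 1) * divPow q a (n 0))
    (fun m n hmn => by simp only [hmn 4 (by decide) (by decide) (by decide),
      hmn 5 (by decide) (by decide) (by decide), hmn 3 (by decide) (by decide) (by decide)])
    (fun _ _ _ => rfl)
    (fun m => by simp only [V3, mul_one, mul_assoc]) (fun m => by simp only [mul_one, mul_assoc])
  exact comp_chain s1 s2 s3 s4

/-! ### Left multiplication in the basis `E_n` -/

omit h in
theorem mul_monE_right (n₁ n₂ n₃ n₄ n₅ n₆ : ℤ) :
    c * monE q a b c n₁ n₂ n₃ n₄ n₅ n₆ =
      zNum q (n₆ + 1) • monE q a b c n₁ n₂ n₃ n₄ n₅ (n₆ + 1) := by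
  simp only [monE, ← mul_assoc, mul_divPow hq0 hq, smul_mul_assoc]

theorem mul_monE_middle (n₁ n₂ n₃ n₄ n₅ n₆ : ℤ) :
    b * monE q a b c n₁ n₂ n₃ n₄ n₅ n₆ =
      (q ^ (n₆ - n₅) * zNum q (n₃ + 1)) • monE q a b c n₁ n₂ (n₃ + 1) n₄ n₅ n₆ +
      zNum q (n₅ + 1) • monE q a b c n₁ n₂ n₃ n₄ (n₅ + 1) (n₆ - 1) := by
  have hn := qNum_ne_zero hq0 hq one_pos
  have h1 := mul_divPow_qBracket hq0 hq ((qBracket_mul_iff hq0 hn b c).mpr h.bc.right) n₆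
  have h2 := scalar_comm_divPow q ((mul_qBracket_iff hq0 hn b c).mpr h.bc.left) n₅
  have h3 := (commute_divPow_left q (h.commute_qBracket_qBracket hq0 hq) n₄).eq
  have e : q ^ (n₆ - n₅) = q ^ n₆ * q⁻¹ ^ n₅ := by
    rw [zpow_sub₀ hq0, inv_zpow, div_eq_mul_inv]
  simp only [monE, ← mul_assoc, h1, add_mul, smul_mul_assoc, e]
  rw [mul_assoc _ b, h2, mul_assoc (divPow q c (n₆ - 1)), mul_divPow hq0 hq]
  simp only [mul_smul_comm, smul_mul_assoc, ← mul_assoc]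
  rw [mul_assoc _ b, ← h3, mul_assoc _ _ (divPow q b n₃), mul_assoc _ b, mul_divPow hq0 hq]
  simp only [mul_smul_comm, smul_mul_assoc, ← mul_assoc, smul_smul]

theorem mul_monE_left (n₁ n₂ n₃ n₄ n₅ n₆ : ℤ) :
    a * monE q a b c n₁ n₂ n₃ n₄ n₅ n₆ =
      (q ^ (n₅ - n₄ + n₃ - n₂) * zNum q (n₁ + 1)) • monE q a b c (n₁ + 1) n₂ n₃ n₄ n₅ n₆ +
      (q ^ (n₅ - n₄) * zNum q (n₂ + 1)) • monE q a b c n₁ (n₂ + 1) (n₃ - 1) n₄ n₅ n₆ +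
      zNum q (n₄ + 1) • monE q a b c n₁ n₂ n₃ (n₄ + 1) (n₅ - 1) n₆ := by
  have hn := qNum_ne_zero hq0 hq one_pos
  have hp := h.serrePair_qBracket_right hq0 hq
  have h0 := (commute_divPow_left q h.ac.symm n₆).eq
  have h1 := mul_divPow_qBracket hq0 hq ((qBracket_mul_iff hq0 hn a _).mpr hp.right) n₅
  have h2 := scalar_comm_divPow q ((mul_qBracket_iff hq0 hn a _).mpr hp.left) n₄
  have h3 := mul_divPow_qBracket hq0 hq ((qBracket_mul_iff hq0 hn a b).mpr h.ab.right) n₃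
  have h4 := scalar_comm_divPow q ((mul_qBracket_iff hq0 hn a b).mpr h.ab.left) n₂
  have e : q ^ (n₅ - n₄) = q ^ n₅ * q⁻¹ ^ n₄ := by
    rw [zpow_sub₀ hq0, inv_zpow, div_eq_mul_inv]
  have e' : q ^ (n₅ - n₄ + n₃ - n₂) = q ^ n₅ * q⁻¹ ^ n₄ * q ^ n₃ * q⁻¹ ^ n₂ := by
    rw [zpow_sub₀ hq0, zpow_add₀ hq0, e, inv_zpow q n₂, div_eq_mul_inv]
  simp only [monE, ← mul_assoc, e, e']
  rw [← h0, mul_assoc _ a, h1]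
  simp only [mul_add, add_mul, mul_smul_comm, smul_mul_assoc, ← mul_assoc]
  rw [mul_assoc _ a, h2, mul_assoc _ (qBracket q a (qBracket q b c)), mul_divPow hq0 hq]
  simp only [mul_smul_comm, smul_mul_assoc, ← mul_assoc]
  rw [mul_assoc _ a, h3]
  simp only [mul_add, add_mul, mul_smul_comm, smul_mul_assoc, ← mul_assoc]
  rw [mul_assoc _ a, h4, mul_assoc _ (qBracket q a b), mul_divPow hq0 hq]
  simp only [mul_smul_comm, smul_mul_assoc, ← mul_assoc]
  rw [mul_assoc _ a, mul_divPow hq0 hq]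
  simp only [mul_smul_comm, smul_add, smul_smul, mul_assoc]

end

/-! ### The monomials `E_n` span `B_3` -/

theorem isSerreTriple_gen (q : K) : IsSerreTriple q (e1 q) (e2 q) (e3 q) := by
  have adj : ∀ i j : Fin 3, ((i : ℕ) + 1 = j ∨ (j : ℕ) + 1 = i) →
      gen q 3 i ^ 2 * gen q 3 j + gen q 3 j * gen q 3 i ^ 2 =
        (q⁻¹ + q) • (gen q 3 i * gen q 3 j * gen q 3 i) := by
    intro i j hij
    simpa [gen] using RingQuot.mkAlgHom_rel K (SerreRel.adjacent (q := q) i j hij)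
  refine ⟨⟨adj 0 1 (by decide), adj 1 0 (by decide)⟩, ⟨adj 1 2 (by decide), adj 2 1 (by decide)⟩,
    ?_⟩
  have := RingQuot.mkAlgHom_rel K (SerreRel.distant (q := q) (n := 3) 0 2 (by decide))
  rw [map_mul, map_mul] at this
  exact this

theorem pbw_eq_monE (q : K) (n : Fin 6 → ℕ) :
    pbw q n = monE q (e1 q) (e2 q) (e3 q) (n 0) (n 1) (n 2) (n 3) (n 4) (n 5) := by
  simp only [pbw, monE, divPow_natCast, normFactor, Fin.prod_univ_six, smul_mul_smul_comm,
    e23, e123, e12, mul_inv]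
  congr 1
  ring

theorem pbwTilde_eq_monEt (q : K) (m : Fin 6 → ℕ) :
    pbwTilde q m = monEt q (e1 q) (e2 q) (e3 q) (m 0) (m 1) (m 2) (m 3) (m 4) (m 5) := by
  simp only [pbwTilde, monEt, divPow_natCast, normFactor, Fin.prod_univ_six, smul_mul_smul_comm,
    e23t, e123t, e12t, mul_inv]
  congr 1
  ring

/-- With a negative exponent the monomial is zero. -/
theorem monE_mem_span (q : K) (n₁ n₂ n₃ n₄ n₅ n₆ : ℤ) :
    monE q (e1 q) (e2 q) (e3 q) n₁ n₂ n₃ n₄ n₅ n₆ ∈ Submodule.span K (Set.range (pbw q)) := by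
  by_cases hn : 0 ≤ n₁ ∧ 0 ≤ n₂ ∧ 0 ≤ n₃ ∧ 0 ≤ n₄ ∧ 0 ≤ n₅ ∧ 0 ≤ n₆
  · obtain ⟨h1, h2, h3, h4, h5, h6⟩ := hn
    lift n₁ to ℕ using h1
    lift n₂ to ℕ using h2
    lift n₃ to ℕ using h3
    lift n₄ to ℕ using h4
    lift n₅ to ℕ using h5
    lift n₆ to ℕ using h6
    exact Submodule.subset_span ⟨![n₁, n₂, n₃, n₄, n₅, n₆], pbw_eq_monE q _⟩
  · have : monE q (e1 q) (e2 q) (e3 q) n₁ n₂ n₃ n₄ n₅ n₆ = 0 := by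
      simp only [not_and_or, not_le] at hn
      rcases hn with h | h | h | h | h | h <;> simp [monE, divPow_of_neg q _ h]
    rw [this]
    exact Submodule.zero_mem _

/-- A subspace stable under left multiplication by the generators is a left ideal. -/
theorem mul_mem_of_gen_mul_mem {q : K} {S : Submodule K (Nilp q 3)}
    (hS : ∀ i, ∀ s ∈ S, gen q 3 i * s ∈ S) (z : Nilp q 3) : ∀ s ∈ S, z * s ∈ S := by
  obtain ⟨w, rfl⟩ := RingQuot.mkAlgHom_surjective K (SerreRel q 3) z
  induction w using FreeAlgebra.induction with
  | grade0 r =>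
    intro s hs
    rw [AlgHom.commutes, ← Algebra.smul_def]
    exact S.smul_mem r hs
  | grade1 i => exact hS i
  | mul u v hu hv =>
    intro s hs
    rw [map_mul, mul_assoc]
    exact hu _ (hv _ hs)
  | add u v hu hv =>
    intro s hs
    rw [map_add, add_mul]
    exact S.add_mem (hu _ hs) (hv _ hs)

theorem span_pbw {q : K} (hq0 : q ≠ 0) (hq : ∀ n : ℕ, 0 < n → q ^ n ≠ 1) :
    ⊤ ≤ Submodule.span K (Set.range (pbw q)) := by
  have h := isSerreTriple_gen q
  have key : ∀ i, ∀ s ∈ Submodule.span K (Set.range (pbw q)),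
      gen q 3 i * s ∈ Submodule.span K (Set.range (pbw q)) := by
    intro i s hs
    induction hs using Submodule.span_induction with
    | mem x hx =>
      obtain ⟨n, rfl⟩ := hx
      rw [pbw_eq_monE]
      fin_cases i
      · change e1 q * _ ∈ _
        rw [mul_monE_left hq0 hq h]
        exact add_mem (add_mem (Submodule.smul_mem _ _ (monE_mem_span _ _ _ _ _ _ _))
          (Submodule.smul_mem _ _ (monE_mem_span _ _ _ _ _ _ _)))
          (Submodule.smul_mem _ _ (monE_mem_span _ _ _ _ _ _ _))
      · change e2 q * _ ∈ _
        rw [mul_monE_middle hq0 hq h]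
        exact add_mem (Submodule.smul_mem _ _ (monE_mem_span _ _ _ _ _ _ _))
          (Submodule.smul_mem _ _ (monE_mem_span _ _ _ _ _ _ _))
      · change e3 q * _ ∈ _
        rw [mul_monE_right hq0 hq]
        exact Submodule.smul_mem _ _ (monE_mem_span _ _ _ _ _ _ _)
    | zero => rw [mul_zero]; exact Submodule.zero_mem _
    | add x y _ _ hx hy => rw [mul_add]; exact add_mem hx hy
    | smul r x _ hx => rw [mul_smul_comm]; exact Submodule.smul_mem _ _ hx
  intro z _
  have h1 : (1 : Nilp q 3) ∈ Submodule.span K (Set.range (pbw q)) := by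
    have := monE_mem_span q 0 0 0 0 0 0
    simpa [monE, divPow_zero] using this
  simpa using mul_mem_of_gen_mul_mem key z 1 h1

/-! ### A representation on functions of six integers -/

/-- The homomorphism from `B_3` given by three elements that satisfy its relations. -/
noncomputable def nilpLift {q : K} {a b c : A} (h : IsSerreTriple q a b c) : Nilp q 3 →ₐ[K] A :=
  RingQuot.liftAlgHom K ⟨FreeAlgebra.lift K ![a, b, c], by
    intro x y hxy
    have hac := h.ac.eq
    cases hxy with
    | adjacent i j hij =>
      fin_cases i <;> fin_cases j <;> simp at hij <;> simp only [map_add, map_mul, map_pow,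
        map_smul, FreeAlgebra.lift_ι_apply]
      exacts [h.ab.left, h.ab.right, h.bc.left, h.bc.right]
    | distant i j hij =>
      fin_cases i <;> fin_cases j <;> simp at hij <;> simp only [map_mul, FreeAlgebra.lift_ι_apply]
      exacts [hac, hac.symm]⟩

theorem nilpLift_gen {q : K} {a b c : A} (h : IsSerreTriple q a b c) (i : Fin 3) :
    nilpLift h (gen q 3 i) = ![a, b, c] i := by
  simp [nilpLift, gen]

/-- Functions of six integers with values in `K`. -/
abbrev SixFun (K : Type*) : Type _ := ℤ → ℤ → ℤ → ℤ → ℤ → ℤ → K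

/-- The action of `e_1`: the transpose of left multiplication by `e_1` on the monomials `[n]! E_n`,
extended by the same formula to all integer exponents. Transposition reverses products, but the
defining relations of `B_3` are invariant under reversal. -/
def opA (q : K) : Module.End K (SixFun K) where
  toFun f := fun n₁ n₂ n₃ n₄ n₅ n₆ =>
    q ^ (n₅ - n₄ + n₃ - n₂) * f (n₁ + 1) n₂ n₃ n₄ n₅ n₆ +
      q ^ (n₅ - n₄) * zNum q n₃ * f n₁ (n₂ + 1) (n₃ - 1) n₄ n₅ n₆ +
      zNum q n₅ * f n₁ n₂ n₃ (n₄ + 1) (n₅ - 1) n₆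
  map_add' f g := by funext; simp only [Pi.add_apply]; ring
  map_smul' r f := by
    funext; simp only [Pi.smul_apply, smul_eq_mul, RingHom.id_apply]; ring

/-- The action of `e_2`. -/
def opB (q : K) : Module.End K (SixFun K) where
  toFun f := fun n₁ n₂ n₃ n₄ n₅ n₆ =>
    q ^ (n₆ - n₅) * f n₁ n₂ (n₃ + 1) n₄ n₅ n₆ + zNum q n₆ * f n₁ n₂ n₃ n₄ (n₅ + 1) (n₆ - 1)
  map_add' f g := by funext; simp only [Pi.add_apply]; ring
  map_smul' r f := by
    funext; simp only [Pi.smul_apply, smul_eq_mul, RingHom.id_apply]; ring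

/-- The action of `e_3`. -/
def opC (K : Type*) [Field K] : Module.End K (SixFun K) where
  toFun f := fun n₁ n₂ n₃ n₄ n₅ n₆ => f n₁ n₂ n₃ n₄ n₅ (n₆ + 1)
  map_add' _ _ := rfl
  map_smul' _ _ := rfl

theorem opA_apply (q : K) (f : SixFun K) (n₁ n₂ n₃ n₄ n₅ n₆ : ℤ) :
    opA q f n₁ n₂ n₃ n₄ n₅ n₆ =
      q ^ (n₅ - n₄ + n₃ - n₂) * f (n₁ + 1) n₂ n₃ n₄ n₅ n₆ +
        q ^ (n₅ - n₄) * zNum q n₃ * f n₁ (n₂ + 1) (n₃ - 1) n₄ n₅ n₆ +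
        zNum q n₅ * f n₁ n₂ n₃ (n₄ + 1) (n₅ - 1) n₆ := rfl

theorem opB_apply (q : K) (f : SixFun K) (n₁ n₂ n₃ n₄ n₅ n₆ : ℤ) :
    opB q f n₁ n₂ n₃ n₄ n₅ n₆ =
      q ^ (n₆ - n₅) * f n₁ n₂ (n₃ + 1) n₄ n₅ n₆ +
        zNum q n₆ * f n₁ n₂ n₃ n₄ (n₅ + 1) (n₆ - 1) := rfl

theorem opC_apply (f : SixFun K) (n₁ n₂ n₃ n₄ n₅ n₆ : ℤ) :
    opC K f n₁ n₂ n₃ n₄ n₅ n₆ = f n₁ n₂ n₃ n₄ n₅ (n₆ + 1) := rfl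

section

variable {q : K} (hq0 : q ≠ 0)
include hq0

theorem serrePair_opB_opC : IsSerrePair q (opB q) (opC K) := by
  constructor
  all_goals
    refine LinearMap.ext fun f => ?_
    funext n₁ n₂ n₃ n₄ n₅ n₆
    simp only [LinearMap.add_apply, LinearMap.smul_apply, Pi.add_apply, Pi.smul_apply, pow_two,
      Module.End.mul_apply, opB_apply, opC_apply, smul_eq_mul, zNum, zpow_neg, zpow_add₀ hq0,
      zpow_sub₀ hq0, zpow_one, add_sub_cancel_right, sub_add_cancel]
    have h5 := zpow_ne_zero n₅ hq0
    have h6 := zpow_ne_zero n₆ hq0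
    field_simp
    ring

omit hq0 in
theorem commute_opA_opC : Commute (opA q) (opC K) := by
  refine LinearMap.ext fun f => ?_
  funext n₁ n₂ n₃ n₄ n₅ n₆
  simp only [Module.End.mul_apply, opA_apply, opC_apply]

theorem serrePair_opA_opB : IsSerrePair q (opA q) (opB q) := by
  constructor
  all_goals
    refine LinearMap.ext fun f => ?_
    funext n₁ n₂ n₃ n₄ n₅ n₆
    simp only [LinearMap.add_apply, LinearMap.smul_apply, Pi.add_apply, Pi.smul_apply, pow_two,
      Module.End.mul_apply, opA_apply, opB_apply, smul_eq_mul, zNum, zpow_neg, zpow_add₀ hq0,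
      zpow_sub₀ hq0, zpow_one, add_sub_cancel_right, sub_add_cancel]
    have h2 := zpow_ne_zero n₂ hq0
    have h3 := zpow_ne_zero n₃ hq0
    have h4 := zpow_ne_zero n₄ hq0
    have h5 := zpow_ne_zero n₅ hq0
    have h6 := zpow_ne_zero n₆ hq0
    generalize q ^ n₂ = x₂ at *
    generalize q ^ n₃ = x₃ at *
    generalize q ^ n₄ = x₄ at *
    generalize q ^ n₅ = x₅ at *
    generalize q ^ n₆ = x₆ at *
    field_simp
    ring

end

theorem isSerreTriple_opA_opB_opC {q : K} (hq0 : q ≠ 0) : IsSerreTriple q (opA q) (opB q) (opC K) :=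
  ⟨serrePair_opA_opB hq0, serrePair_opB_opC hq0, commute_opA_opC⟩

/-- If `W` raises the label of the linear functionals `ev k` by one, then its divided powers shift
this label. -/
theorem divPow_eval {M : Type*} [AddCommGroup M] [Module K M] (q : K) {W : Module.End K M}
    (ev : ℤ → M → K) (hsmul : ∀ k (r : K) f, ev k (r • f) = r * ev k f)
    (hW : ∀ k f, ev k (W f) = ev (k + 1) f) (n : ℕ) (f : M) :
    ev 0 (divPow q W n f) = (qFact q n)⁻¹ * ev n f := by
  have key : ∀ k, ev k ((W ^ n) f) = ev (k + n) f := by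
    induction n with
    | zero => simp
    | succ n ih =>
      intro k
      rw [pow_succ', Module.End.mul_apply, hW, ih]
      push_cast
      ring_nf
  rw [divPow_natCast, LinearMap.smul_apply, hsmul, key, zero_add]

/-- The monomials `Ẽ_m` move the evaluation at the origin to the evaluation at `m`. -/
theorem monEt_op_apply {q : K} (hq0 : q ≠ 0) (hq : ∀ n : ℕ, 0 < n → q ^ n ≠ 1) (m : Fin 6 → ℕ)
    (f : SixFun K) :
    monEt q (opA q) (opB q) (opC K) (m 0) (m 1) (m 2) (m 3) (m 4) (m 5) f 0 0 0 0 0 0 =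
      (normFactor q m)⁻¹ * f (m 0) (m 1) (m 2) (m 3) (m 4) (m 5) := by
  have h1 : 1 - q ^ 2 ≠ 0 := sub_ne_zero.mpr (hq 2 two_pos).symm
  have hbt : Commute (qBracket q (qBracket q (opC K) (opB q)) (opA q)) (opB q) := by
    have h := (isSerreTriple_opA_opB_opC hq0).symm
    rw [qBracket_assoc q _ h.ac]; exact h.commute_qBracket_qBracket hq0 hq
  have s1 := divPow_eval q (W := opA q) (fun k f => f k 0 0 0 0 0) (fun _ _ _ => rfl)
    (fun k f => by simp [opA_apply, zNum_zero])
  have s2 := fun n₁ => divPow_eval q (W := qBracket q (opB q) (opA q))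
    (fun k f => f n₁ k 0 0 0 0) (fun _ _ _ => rfl)
    (fun k f => by
      simp [qBracket, Module.End.mul_apply, opA_apply, opB_apply, zNum, qNum,
        zpow_sub₀ hq0]
      field_simp
      ring)
  have s3 := fun n₁ n₂ => divPow_eval q (W := opB q)
    (fun k f => f n₁ n₂ k 0 0 0) (fun _ _ _ => rfl)
    (fun k f => by simp [opB_apply, zNum_zero])
  have s4 := fun n₁ n₂ n₃ => divPow_eval q
    (W := qBracket q (qBracket q (opC K) (opB q)) (opA q))
    (fun k f => f n₁ n₂ n₃ k 0 0) (fun _ _ _ => rfl)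
    (fun k f => by
      have h2 := zpow_ne_zero n₂ hq0
      have h3 := zpow_ne_zero n₃ hq0
      have h4 := zpow_ne_zero k hq0
      simp [qBracket, Module.End.mul_apply, opA_apply, opB_apply, opC_apply, zNum, qNum,
        zpow_sub₀ hq0, zpow_add₀ hq0]
      field_simp
      ring)
  have s5 := fun n₁ n₂ n₃ n₄ => divPow_eval q (W := qBracket q (opC K) (opB q))
    (fun k f => f n₁ n₂ n₃ n₄ k 0) (fun _ _ _ => rfl)
    (fun k f => by
      simp [qBracket, Module.End.mul_apply, opB_apply, opC_apply, zNum, qNum,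
        zpow_sub₀ hq0]
      field_simp
      ring)
  have s6 := fun n₁ n₂ n₃ n₄ n₅ => divPow_eval q (W := opC K)
    (fun k f => f n₁ n₂ n₃ n₄ n₅ k) (fun _ _ _ => rfl) (fun k f => rfl)
  rw [monEt, mul_assoc (divPow q (opA q) _ * _), (commute_divPow q hbt _ _).eq]
  simp only [Module.End.mul_apply]
  rw [s1, s2, s3, s4, s5, s6]
  simp only [normFactor, Fin.prod_univ_six, mul_inv]
  ring

theorem map_qBracket {B : Type*} [Ring B] [Algebra K B] (φ : A →ₐ[K] B) (q : K) (x y : A) :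
    φ (qBracket q x y) = qBracket q (φ x) (φ y) := by
  simp [qBracket]

theorem map_divPow {B : Type*} [Ring B] [Algebra K B] (φ : A →ₐ[K] B) (q : K) (x : A) (n : ℤ) :
    φ (divPow q x n) = divPow q (φ x) n := by
  cases n with
  | ofNat n => simp [divPow_natCast]
  | negSucc n => simp [divPow]

theorem map_monE {B : Type*} [Ring B] [Algebra K B] (φ : A →ₐ[K] B) (q : K) (a b c : A)
    (n₁ n₂ n₃ n₄ n₅ n₆ : ℤ) :
    φ (monE q a b c n₁ n₂ n₃ n₄ n₅ n₆) = monE q (φ a) (φ b) (φ c) n₁ n₂ n₃ n₄ n₅ n₆ := by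
  simp [monE, map_divPow, map_qBracket]

theorem map_monEt {B : Type*} [Ring B] [Algebra K B] (φ : A →ₐ[K] B) (q : K) (a b c : A)
    (n₁ n₂ n₃ n₄ n₅ n₆ : ℤ) :
    φ (monEt q a b c n₁ n₂ n₃ n₄ n₅ n₆) = monEt q (φ a) (φ b) (φ c) n₁ n₂ n₃ n₄ n₅ n₆ := by
  simp [monEt, map_divPow, map_qBracket]

/-! ### Reversal of products and the two bases -/

open MulOpposite

theorem qBracket_op (q : K) (x y : A) : qBracket q (op x) (op y) = op (qBracket q y x) := by
  simp [qBracket]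

theorem divPow_op (q : K) (x : A) (n : ℤ) : divPow q (op x) n = op (divPow q x n) := by
  cases n with
  | ofNat n => simp [divPow_natCast]
  | negSucc n => simp [divPow]

theorem IsSerrePair.op {q : K} {x y : A} (h : IsSerrePair q x y) :
    IsSerrePair q (op x) (op y) := by
  constructor
  · have := congrArg MulOpposite.op h.left
    simpa [mul_assoc, add_comm] using this
  · have := congrArg MulOpposite.op h.right
    simpa [mul_assoc, add_comm] using this

theorem IsSerreTriple.op {q : K} {a b c : A} (h : IsSerreTriple q a b c) :
    IsSerreTriple q (op a) (op b) (op c) :=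
  ⟨h.ab.op, h.bc.op, h.ac.op⟩

section

variable {q : K} (hq0 : q ≠ 0) (hq : ∀ n : ℕ, 0 < n → q ^ n ≠ 1)

/-- The reversal of products in `B_3`: the anti-automorphism fixing the generators. -/
noncomputable def reversal (q : K) : Nilp q 3 →ₗ[K] Nilp q 3 :=
  (MulOpposite.opLinearEquiv K).symm.toLinearMap ∘ₗ
    (nilpLift (isSerreTriple_gen q).op).toLinearMap

theorem reversal_mul (q : K) (x y : Nilp q 3) :
    reversal q (x * y) = reversal q y * reversal q x := by
  simp [reversal]

theorem reversal_gen (q : K) (i : Fin 3) : reversal q (gen q 3 i) = gen q 3 i := by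
  have := nilpLift_gen (isSerreTriple_gen q).op i
  simp only [reversal, LinearMap.comp_apply, AlgHom.toLinearMap_apply, this]
  fin_cases i <;> rfl

theorem reversal_surjective (q : K) : Function.Surjective (reversal q) := by
  intro z
  have h1 : (1 : Nilp q 3) ∈ LinearMap.range (reversal q) := ⟨1, by simp [reversal]⟩
  have := mul_mem_of_gen_mul_mem (S := LinearMap.range (reversal q)) (by
    rintro i _ ⟨w, rfl⟩
    exact ⟨w * gen q 3 i, by rw [reversal_mul, reversal_gen]⟩) z 1 h1
  simpa using this

include hq0 hq

theorem reversal_pbw (n : Fin 6 → ℕ) : reversal q (pbw q n) = pbwTilde q n := by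
  have h := isSerreTriple_gen q
  have hbt : Commute (qBracket q (qBracket q (e3 q) (e2 q)) (e1 q)) (e2 q) := by
    rw [qBracket_assoc q _ h.symm.ac]; exact h.symm.commute_qBracket_qBracket hq0 hq
  have g1 : nilpLift h.op (e1 q) = op (e1 q) := nilpLift_gen h.op 0
  have g2 : nilpLift h.op (e2 q) = op (e2 q) := nilpLift_gen h.op 1
  have g3 : nilpLift h.op (e3 q) = op (e3 q) := nilpLift_gen h.op 2
  rw [pbw_eq_monE, pbwTilde_eq_monEt]
  simp only [reversal, LinearMap.comp_apply, AlgHom.toLinearMap_apply]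
  rw [map_monE, g1, g2, g3]
  simp only [monE, divPow_op, qBracket_op, ← op_mul]
  simp only [LinearEquiv.coe_coe, coe_opLinearEquiv_symm, unop_op, monEt, mul_assoc,
    (commute_divPow q hbt _ _).left_comm]

theorem linearIndependent_pbwTilde : LinearIndependent K (pbwTilde q) := by
  classical
  have h := isSerreTriple_opA_opB_opC hq0
  -- The functionals that apply an element to the delta function at `n` and evaluate at the origin.
  let δ : (Fin 6 → ℕ) → SixFun K := fun n n₁ n₂ n₃ n₄ n₅ n₆ =>
    if n₁ = n 0 ∧ n₂ = n 1 ∧ n₃ = n 2 ∧ n₄ = n 3 ∧ n₅ = n 4 ∧ n₆ = n 5 then 1 else 0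
  let L : Nilp q 3 →ₗ[K] ((Fin 6 → ℕ) → K) :=
    { toFun := fun x n => nilpLift h x (δ n) 0 0 0 0 0 0
      map_add' := fun x y => by funext n; simp
      map_smul' := fun r x => by funext n; simp }
  have g1 : nilpLift h (e1 q) = opA q := nilpLift_gen h 0
  have g2 : nilpLift h (e2 q) = opB q := nilpLift_gen h 1
  have g3 : nilpLift h (e3 q) = opC K := nilpLift_gen h 2
  have hL : (L ∘ pbwTilde q) = fun m => Pi.single m (normFactor q m)⁻¹ := by
    funext m n
    change nilpLift h (pbwTilde q m) (δ n) 0 0 0 0 0 0 = _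
    rw [pbwTilde_eq_monEt, map_monEt, g1, g2, g3, monEt_op_apply hq0 hq, Pi.single_apply]
    simp only [δ, Nat.cast_inj]
    by_cases hnm : n = m
    · subst hnm; simp
    · rw [if_neg hnm, if_neg, mul_zero]
      rintro ⟨h0, h1, h2, h3, h4, h5⟩
      exact hnm (by funext s; fin_cases s <;> simp [*])
  refine LinearIndependent.of_comp L ?_
  rw [hL]
  exact Pi.linearIndependent_single_of_ne_zero fun m => inv_ne_zero
    (Finset.prod_ne_zero_iff.mpr fun _ _ => qFact_ne_zero hq0 hq _)

theorem linearIndependent_pbw : LinearIndependent K (pbw q) := by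
  refine LinearIndependent.of_comp (reversal q) ?_
  rw [show reversal q ∘ pbw q = pbwTilde q from funext (reversal_pbw hq0 hq)]
  exact linearIndependent_pbwTilde hq0 hq

theorem span_pbwTilde : ⊤ ≤ Submodule.span K (Set.range (pbwTilde q)) := by
  rw [← show reversal q ∘ pbw q = pbwTilde q from funext (reversal_pbw hq0 hq), Set.range_comp,
    ← Submodule.map_span, top_le_iff.mp (span_pbw hq0 hq), Submodule.map_top,
    LinearMap.range_eq_top.mpr (reversal_surjective q)]

/-- The basis `E_n`. -/
noncomputable def pbwBasis : Module.Basis (Fin 6 → ℕ) K (Nilp q 3) :=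
  Module.Basis.mk (linearIndependent_pbw hq0 hq) (span_pbw hq0 hq)

/-- The basis `Ẽ_m`. -/
noncomputable def pbwTildeBasis : Module.Basis (Fin 6 → ℕ) K (Nilp q 3) :=
  Module.Basis.mk (linearIndependent_pbwTilde hq0 hq) (span_pbwTilde hq0 hq)

/-- A factorisation of `e_m ↦ Ẽ_m` through `e_n ↦ E_n` gives the transition coefficients. -/
theorem pbwBasis_repr_pbwTilde {T T' : Module.End K (Fock6 K)} (hT : IsTranspose T T')
    (h : Finsupp.linearCombination K (pbwTilde q) =
      Finsupp.linearCombination K (pbw q) ∘ₗ T') (m n : Fin 6 → ℕ) :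
    (pbwBasis hq0 hq).repr (pbwTilde q m) n = matElem T m n := by
  have hb : ⇑(pbwBasis hq0 hq) = pbw q := Module.Basis.coe_mk _ _
  have h1 := LinearMap.congr_fun h (Finsupp.single m 1)
  rw [Finsupp.linearCombination_single, one_smul, LinearMap.comp_apply, ← hb] at h1
  rw [h1, Module.Basis.repr_linearCombination, hT m n, matElem]

theorem repr_eq_T₁ (m n : Fin 6 → ℕ) :
    (pbwBasis hq0 hq).repr (pbwTilde q m) n = matElem (T₁ q) m n := by
  refine pbwBasis_repr_pbwTilde hq0 hq ((((isTranspose_rOp (by decide) (by decide) (by decide)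
    q).mul (isTranspose_rOp (by decide) (by decide) (by decide) q)).mul
    (isTranspose_rOp (by decide) (by decide) (by decide) q)).mul
    (isTranspose_rOp (by decide) (by decide) (by decide) q)) ?_ m n
  rw [show pbw q = _ from funext (pbw_eq_monE q),
    show pbwTilde q = _ from funext (pbwTilde_eq_monEt q)]
  exact linearCombination_monEt_T₁ hq0 hq (isSerreTriple_gen q)

theorem repr_eq_T₂ (m n : Fin 6 → ℕ) :
    (pbwBasis hq0 hq).repr (pbwTilde q m) n = matElem (T₂ q) m n := by
  refine pbwBasis_repr_pbwTilde hq0 hq ((((isTranspose_rOp (by decide) (by decide) (by decide)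
    q).mul (isTranspose_rOp (by decide) (by decide) (by decide) q)).mul
    (isTranspose_rOp (by decide) (by decide) (by decide) q)).mul
    (isTranspose_rOp (by decide) (by decide) (by decide) q)) ?_ m n
  rw [show pbw q = _ from funext (pbw_eq_monE q),
    show pbwTilde q = _ from funext (pbwTilde_eq_monEt q)]
  exact linearCombination_monEt_T₂ hq0 hq (isSerreTriple_gen q)

end

/-! ### The constant tetrahedron equation -/

theorem end_ext_matElem {S S' : Module.End K (Fock6 K)}
    (h : ∀ m n, matElem S m n = matElem S' m n) : S = S' :=
  Finsupp.lhom_ext' fun n => LinearMap.ext_ring (Finsupp.ext fun m => h m n)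

/-- Both sides are the transition matrix between the two bases. -/
theorem T₁_eq_T₂ {q : K} (hq0 : q ≠ 0) (hq : ∀ n : ℕ, 0 < n → q ^ n ≠ 1) : T₁ q = T₂ q :=
  end_ext_matElem fun m n => (repr_eq_T₁ hq0 hq m n).symm.trans (repr_eq_T₂ hq0 hq m n)

/-! ### Spectral parameters -/

/-- The diagonal operator `|n⟩ ↦ (∏ g_s ^ n_s) |n⟩`. -/
noncomputable def diagOp (g : Fin 6 → K) : Module.End K (Fock6 K) :=
  Finsupp.linearCombination K fun n => Finsupp.single n (∏ s, g s ^ n s)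

theorem matElem_mul_diagonal (S : Module.End K (Fock6 K)) (d : (Fin 6 → ℕ) → K)
    (m n : Fin 6 → ℕ) :
    matElem (S * Finsupp.linearCombination K fun n => Finsupp.single n (d n)) m n =
      matElem S m n * d n := by
  simp only [matElem, Module.End.mul_apply, Finsupp.linearCombination_single, one_smul]
  rw [← mul_one (d n), ← smul_eq_mul, ← Finsupp.smul_single, map_smul]
  simp [mul_comm]

theorem matElem_diagonal_mul (S : Module.End K (Fock6 K)) (d : (Fin 6 → ℕ) → K)
    (m n : Fin 6 → ℕ) :
    matElem ((Finsupp.linearCombination K fun n => Finsupp.single n (d n)) * S) m n =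
      d m * matElem S m n := by
  simp only [matElem, Module.End.mul_apply]
  rw [end_apply_eq_sum, Finsupp.sum, Finset.sum_eq_single m]
  · simp [matElem, mul_comm]
  · intro k _ hk
    simp [matElem, hk]
  · intro hm
    rw [Finsupp.notMem_support_iff.mp hm, zero_mul]

theorem matElem_ROp (q : K) (l u : Fin 6 → K) (i j k : Fin 6) (m n : Fin 6 → ℕ) :
    matElem (ROp q l u i j k) m n = (-(l i * u k) / q) ^ m j * rEntry q i j k m n *
      (l k / l j) ^ n i * (u i / u j) ^ n k := by
  unfold ROp powN
  rw [matElem_mul_diagonal, matElem_mul_diagonal, matElem_diagonal_mul, matElem_rOp]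

theorem prod_eq_three {i j k : Fin 6} (hij : i ≠ j) (hik : i ≠ k) (hjk : j ≠ k) (f : Fin 6 → K) :
    ∏ s, f s = f i * f j * f k * ∏ s ∈ Finset.univ \ {i, j, k}, f s := by
  rw [← Finset.prod_sdiff (Finset.subset_univ {i, j, k}), Finset.prod_insert (by simp [hij, hik]),
    Finset.prod_insert (by simp [hjk]), Finset.prod_singleton]
  ring

/-- Moving a diagonal operator through `R_{ijk}` absorbs its spectral parameters. By the
conservation of `m_i + m_j` and `m_j + m_k`, a diagonal operator with weights `w` commutes with
`r_{ijk}` as soon as `w_j = w_i w_k`; this is the hypothesis `hc`, for the weights that arise when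
the diagonal factors on the right of `r_{ijk}` are included. -/
theorem ROp_mul_diagOp (q : K) (l u : Fin 6 → K) {i j k : Fin 6} (hij : i ≠ j) (hik : i ≠ k)
    (hjk : j ≠ k) (g g' : Fin 6 → K) (hi : g' i = l k / l j * g i) (hk : g' k = u i / u j * g k)
    (hj : g' j = -(l i * u k) / q * g j) (hc : g j = g' i * g' k)
    (hs : ∀ s, s ≠ i → s ≠ j → s ≠ k → g' s = g s) :
    ROp q l u i j k * diagOp g = diagOp g' * rOp q i j k := by
  refine end_ext_matElem fun m n => ?_
  unfold diagOp
  rw [matElem_mul_diagonal, matElem_diagonal_mul, matElem_ROp, matElem_rOp]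
  by_cases hr : rEntry q i j k m n = 0
  · simp [hr]
  have h1 : ∀ s, s ≠ i → s ≠ j → s ≠ k → m s = n s := by
    by_contra h; exact hr (if_neg h)
  have h2 : m i + m j = n i + n j ∧ m j + m k = n j + n k := by
    rw [rEntry, if_pos h1] at hr
    by_contra h; exact hr (if_neg h)
  rw [prod_eq_three hij hik hjk, prod_eq_three hij hik hjk]
  have h3 : ∏ s ∈ Finset.univ \ {i, j, k}, g s ^ n s =
      ∏ s ∈ Finset.univ \ {i, j, k}, g' s ^ m s := by
    refine Finset.prod_congr rfl fun s hs' => ?_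
    simp only [Finset.mem_sdiff, Finset.mem_univ, true_and, Finset.mem_insert,
      Finset.mem_singleton, not_or] at hs'
    rw [h1 s hs'.1 hs'.2.1 hs'.2.2, hs s hs'.1 hs'.2.1 hs'.2.2]
  have h4 : (l k / l j) ^ n i * (u i / u j) ^ n k * (g i ^ n i * g j ^ n j * g k ^ n k) =
      g' i ^ m i * g j ^ m j * g' k ^ m k := by
    have e1 : g' i ^ (m i + m j) * g' k ^ (m j + m k) =
      g' i ^ (n i + n j) * g' k ^ (n j + n k) := by rw [h2.1, h2.2]
    calc _ = (l k / l j * g i) ^ n i * g j ^ n j * (u i / u j * g k) ^ n k := by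
          rw [mul_pow, mul_pow]; ring
      _ = g' i ^ (n i + n j) * g' k ^ (n j + n k) := by
          rw [← hi, ← hk, hc, mul_pow, pow_add, pow_add]; ring
      _ = _ := by rw [← e1, hc, mul_pow, pow_add, pow_add]; ring
  rw [h3, hj, mul_pow]
  linear_combination ((-(l i * u k) / q) ^ m j * rEntry q i j k m n *
    ∏ s ∈ Finset.univ \ {i, j, k}, g' s ^ m s) * h4

theorem diagOp_mul_diagOp (g h : Fin 6 → K) : diagOp g * diagOp h = diagOp (g * h) := by
  refine end_ext_matElem fun m n => ?_
  conv_lhs => unfold diagOp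
  rw [matElem_mul_diagonal]
  by_cases hnm : n = m
  · subst hnm
    simp [diagOp, matElem, mul_pow, Finset.prod_mul_distrib]
  · simp [diagOp, matElem, hnm]

theorem diagOp_one : diagOp (1 : Fin 6 → K) = 1 := by
  refine end_ext_matElem fun m n => ?_
  simp [diagOp, matElem]

/-- The constant tetrahedron equation implies the one with spectral parameters: multiplication
by diagonal operators absorbs all parameters, in the same way on both sides. -/
theorem ROp_tetrahedron {q : K} (hq0 : q ≠ 0) (hT : T₁ q = T₂ q) (l u : Fin 6 → K)
    (hl : ∀ s, l s ≠ 0) (hu : ∀ s, u s ≠ 0) :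
    ROp q l u 0 1 2 * ROp q l u 0 3 4 * ROp q l u 1 3 5 * ROp q l u 2 4 5 =
      ROp q l u 2 4 5 * ROp q l u 1 3 5 * ROp q l u 0 3 4 * ROp q l u 0 1 2 := by
  -- The weights are found by asking that, starting from `g`, the weight reached before each factor
  -- satisfies the condition for commuting with the corresponding `r`; both orders end at `p`.
  let g : Fin 6 → K := ![l 1 * l 3 / (l 2 * l 4), l 3 / l 5, u 1 * l 4 / (u 0 * l 5), 1, u 3 / u 0,
    u 3 * u 4 / (u 1 * u 2)]
  let p : Fin 6 → K := ![1, -(l 0 * u 2) / q, 1, l 0 * l 1 * u 4 * u 5 / q ^ 2, -(l 2 * u 5) / q, 1]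
  have l0 := hl 0
  have l1 := hl 1
  have l2 := hl 2
  have l3 := hl 3
  have l4 := hl 4
  have l5 := hl 5
  have u0 := hu 0
  have u1 := hu 1
  have u2 := hu 2
  have u3 := hu 3
  have u4 := hu 4
  have u5 := hu 5
  have left : ROp q l u 0 1 2 * ROp q l u 0 3 4 * ROp q l u 1 3 5 * ROp q l u 2 4 5 * diagOp g =
      diagOp p * T₁ q := by
    let g₁ : Fin 6 → K := ![l 1 * l 3 / (l 2 * l 4), l 3 / l 5, u 1 / u 0, 1,
      -(l 2 * u 5) / q * (u 3 / u 0), u 3 / u 1]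
    let g₂ : Fin 6 → K := ![l 1 * l 3 / (l 2 * l 4), 1, u 1 / u 0, -(l 1 * u 5) / q,
      -(l 2 * u 5) / q * (u 3 / u 0), 1]
    let g₃ : Fin 6 → K := ![l 1 / l 2, 1, u 1 / u 0, l 0 * l 1 * u 4 * u 5 / q ^ 2,
      -(l 2 * u 5) / q, 1]
    have s1 := ROp_mul_diagOp q l u (i := 2) (j := 4) (k := 5) (by decide) (by decide) (by decide)
      g g₁ (by simp [g, g₁]; field_simp) (by simp [g, g₁]; field_simp) (by simp [g, g₁])
      (by simp [g, g₁]; field_simp) (by intro s; fin_cases s <;> simp [g, g₁])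
    have s2 := ROp_mul_diagOp q l u (i := 1) (j := 3) (k := 5) (by decide) (by decide) (by decide)
      g₁ g₂ (by simp [g₁, g₂]; field_simp) (by simp [g₁, g₂]; field_simp) (by simp [g₁, g₂])
      (by simp [g₁, g₂]) (by intro s; fin_cases s <;> simp [g₁, g₂])
    have s3 := ROp_mul_diagOp q l u (i := 0) (j := 3) (k := 4) (by decide) (by decide) (by decide)
      g₂ g₃ (by simp [g₂, g₃]; field_simp) (by simp [g₂, g₃]; field_simp)
      (by simp [g₂, g₃]; field_simp)
      (by simp [g₂, g₃]; field_simp) (by intro s; fin_cases s <;> simp [g₂, g₃])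
    have s4 := ROp_mul_diagOp q l u (i := 0) (j := 1) (k := 2) (by decide) (by decide) (by decide)
      g₃ p (by simp [g₃, p]; field_simp) (by simp [g₃, p]; field_simp) (by simp [g₃, p])
      (by simp [g₃, p]) (by intro s; fin_cases s <;> simp [g₃, p])
    rw [mul_assoc, s1, ← mul_assoc, mul_assoc _ _ (diagOp g₁), s2, ← mul_assoc,
      mul_assoc _ _ (diagOp g₂), s3, ← mul_assoc, s4]
    simp only [T₁, mul_assoc]
  have right : ROp q l u 2 4 5 * ROp q l u 1 3 5 * ROp q l u 0 3 4 * ROp q l u 0 1 2 * diagOp g =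
      diagOp p * T₂ q := by
    let g₁ : Fin 6 → K := ![l 3 / l 4, -(l 0 * u 2) / q * (l 3 / l 5), l 4 / l 5, 1, u 3 / u 0,
      u 3 * u 4 / (u 1 * u 2)]
    let g₂ : Fin 6 → K := ![1, -(l 0 * u 2) / q * (l 3 / l 5), l 4 / l 5, -(l 0 * u 4) / q, 1,
      u 3 * u 4 / (u 1 * u 2)]
    let g₃ : Fin 6 → K := ![1, -(l 0 * u 2) / q, l 4 / l 5, l 0 * l 1 * u 4 * u 5 / q ^ 2, 1,
      u 4 / u 2]
    have s1 := ROp_mul_diagOp q l u (i := 0) (j := 1) (k := 2) (by decide) (by decide) (by decide)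
      g g₁ (by simp [g, g₁]; field_simp) (by simp [g, g₁]; field_simp) (by simp [g, g₁])
      (by simp [g, g₁]; field_simp) (by intro s; fin_cases s <;> simp [g, g₁])
    have s2 := ROp_mul_diagOp q l u (i := 0) (j := 3) (k := 4) (by decide) (by decide) (by decide)
      g₁ g₂ (by simp [g₁, g₂]; field_simp) (by simp [g₁, g₂]; field_simp) (by simp [g₁, g₂])
      (by simp [g₁, g₂]) (by intro s; fin_cases s <;> simp [g₁, g₂])
    have s3 := ROp_mul_diagOp q l u (i := 1) (j := 3) (k := 5) (by decide) (by decide) (by decide)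
      g₂ g₃ (by simp [g₂, g₃]; field_simp) (by simp [g₂, g₃]; field_simp)
      (by simp [g₂, g₃]; field_simp)
      (by simp [g₂, g₃]; field_simp) (by intro s; fin_cases s <;> simp [g₂, g₃])
    have s4 := ROp_mul_diagOp q l u (i := 2) (j := 4) (k := 5) (by decide) (by decide) (by decide)
      g₃ p (by simp [g₃, p]; field_simp) (by simp [g₃, p]; field_simp) (by simp [g₃, p])
      (by simp [g₃, p]) (by intro s; fin_cases s <;> simp [g₃, p])
    rw [mul_assoc, s1, ← mul_assoc, mul_assoc _ _ (diagOp g₁), s2, ← mul_assoc,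
      mul_assoc _ _ (diagOp g₂), s3, ← mul_assoc, s4]
    simp only [T₂, mul_assoc]
  have hg : diagOp g * diagOp g⁻¹ = 1 := by
    have : g * g⁻¹ = 1 := by
      funext s
      refine mul_inv_cancel₀ ?_
      fin_cases s <;> simp [g, hl, hu]
    rw [diagOp_mul_diagOp, this, diagOp_one]
  have key := congrArg (· * diagOp g⁻¹) (left.trans (hT ▸ right.symm))
  simpa only [mul_assoc, hg, mul_one] using key

end QTetra

theorem mainTheorem2 {K : Type*} [Field K] (q : K) (hq0 : q ≠ 0)
    (hq : ∀ n : ℕ, 0 < n → q ^ n ≠ 1) :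
    (∃ b b' : Module.Basis (Fin 6 → ℕ) K (QTetra.Nilp q 3),
      (∀ n, b n = QTetra.pbw q n) ∧
      (∀ m, b' m = QTetra.pbwTilde q m) ∧
      (∀ m n, b.repr (b' m) n = QTetra.matElem (QTetra.T₁ q) m n) ∧
      (∀ m n, b.repr (b' m) n = QTetra.matElem (QTetra.T₂ q) m n)) ∧
    QTetra.T₁ q = QTetra.T₂ q ∧
    ∀ l u : Fin 6 → K, (∀ s, l s ≠ 0) → (∀ s, u s ≠ 0) →
      QTetra.ROp q l u 0 1 2 * QTetra.ROp q l u 0 3 4 *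
          QTetra.ROp q l u 1 3 5 * QTetra.ROp q l u 2 4 5 =
        QTetra.ROp q l u 2 4 5 * QTetra.ROp q l u 1 3 5 *
          QTetra.ROp q l u 0 3 4 * QTetra.ROp q l u 0 1 2 := by
  have hb' : ∀ m, QTetra.pbwTildeBasis hq0 hq m = QTetra.pbwTilde q m :=
    fun m => Module.Basis.mk_apply _ _ m
  refine ⟨⟨QTetra.pbwBasis hq0 hq, QTetra.pbwTildeBasis hq0 hq,
    fun n => Module.Basis.mk_apply _ _ n, hb', fun m n => ?_, fun m n => ?_⟩,
    QTetra.T₁_eq_T₂ hq0 hq,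
    QTetra.ROp_tetrahedron hq0 (QTetra.T₁_eq_T₂ hq0 hq)⟩
  · rw [hb', QTetra.repr_eq_T₁ hq0 hq]
  · rw [hb', QTetra.repr_eq_T₂ hq0 hq]
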